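/- Let $S^2\subset\mathbb R^3$ be the unit sphere with round metric $\sigma_{AB}$ (used to raise and lower indices), Levi-Civita connection $\nabla$, area form $\epsilon_{AB}$, Laplacian $\Delta$, and let $\tilde X^k$ ($k=1,2,3$) be the restrictions of the coordinate functions. Let $u_1<u_2$. A set of null infinity data on $[u_1,u_2]\times S^2$ is $(m,N_A,C_{AB},N_{AB})$, where $m$ is a function, $N_A$ a one-form and $C_{AB},N_{AB}$ symmetric traceless 2-tensors on $S^2$, all smooth in $(u,x)\in[u_1,u_2]\times S^2$, such that $\partial_uC_{AB}=N_{AB}$ and $$\partial_u m=\tfrac14\nabla^A\nabla^BN_{AB}-\tfrac18N_{AB}N^{AB},$$ $$\partial_uN_A=\nabla_Am-\tfrac14\nabla^D(\nabla_D\nabla^EC_{EA}-\nabla_A\nabla^EC_{ED})+\tfrac14\nabla_A(C_{BE}N^{BE})-\tfrac14\nabla_B(C^{BD}N_{DA})+\tfrac12C_{AB}\nabla_DN^{DB}.$$ The classical energy, linear momentum, angular momentum and center of mass at time $u$ are $$E=\int_{S^2}2m,\qquad P^k=\int_{S^2}2m\tilde X^k,\qquad \tilde J^k=\int_{S^2}\epsilon^{AB}\nabla_B\tilde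 X^k\big[N_A-\tfrac14C_A{}^D\nabla^BC_{DB}\big],$$ $$\tilde C^k=\int_{S^2}\nabla^A\tilde X^k\big[N_A-u\nabla_Am-\tfrac14C_A{}^D\nabla^BC_{DB}-\tfrac1{16}\nabla_A(C_{DE}C^{DE})\big].$$ Smooth functions $c,\underline c$ on $S^2$ are potentials of a 2-tensor $C_{AB}$ if $C_{AB}=\nabla_A\nabla_Bc-\frac12\sigma_{AB}\Delta c+\frac12(\epsilon_A{}^E\nabla_E\nabla_B\underline c+\epsilon_B{}^E\nabla_E\nabla_A\underline c)$. Put $\varepsilon_2(C)_{AB}=\epsilon_A{}^DC_{DB}$. Theorem. For every set of null infinity data $(m,N_A,C_{AB},N_{AB})$ on $[u_1,u_2]\times S^2$ there is exactly one set of null infinity data $(m^*,N^*_A,C^*_{AB},N^*_{AB})$ on $[u_1,u_2]\times S^2$ with $C^*=\varepsilon_2(C)$, $m^*(u_1,\cdot)=m(u_1,\cdot)$ and $N^*_A(u_1,\cdot)=N_A(u_1,\cdot)$. For this dual set, $N^*_{AB}=\varepsilon_2(N)_{AB}$; at each $u\in[u_1,u_2]$, if $(c,\underline c)$ are potentials of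 $C_{AB}$ and $(n,\underline n)$ are potentials of $N_{AB}$, then $(-\underline c,c)$ are potentials of $C^*_{AB}$ and $(-\underline n,n)$ are potentials of $N^*_{AB}$; and the dual set has the same $E$, $P^k$, $\tilde J^k$ and $\tilde C^k$ ($k=1,2,3$) as the original set at every $u\in[u_1,u_2]$. -/

import Mathlib

noncomputable section

namespace NullInfinity

open scoped Manifold ContDiff

/-! ### Calculus on the round unit sphere

The standard round sphere `S²` is realised as the unit sphere of `ℝ³`.  Tensor fields on `S²` are
written in the Cartesian components of `ℝ³`: a one-form `w_A` is a map `x ↦ (w x i)_i` with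
`∑ i, x i * w x i = 0`, and a covariant 2-tensor is a map `x ↦ (T x i j)_{ij}` that vanishes when
either of its slots is filled with the normal vector `x`.  In these components the round metric
`σ` at `x` is the orthogonal projection `δ_ij - x_i x_j` onto the tangent plane, so that raising
and lowering an index of a tangential tensor leaves its components unchanged, and the contraction
of two indices is a plain sum over `Fin 3`. -/

/-- Euclidean 3-space. -/
abbrev E3 : Type := EuclideanSpace ℝ (Fin 3)

/-- The unit sphere, with the smooth structure and topology of Mathlib. -/
abbrev S2 : Type := Metric.sphere (0 : E3) 1

/-- Integration over `S²` with respect to the area measure of the round metric (total mass `4π`). -/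
def sphereIntegral (f : S2 → ℝ) : ℝ :=
  ∫ x, f x ∂((MeasureTheory.volume : MeasureTheory.Measure E3).toSphere)

/-- The extension of a function on `S²` to `ℝ³ \ {0}` that is constant along rays
(with the irrelevant value `0` at the origin). -/
def radialExt (f : S2 → ℝ) (y : E3) : ℝ :=
  open Classical in
  if h : y ≠ 0 then
    f ⟨‖y‖⁻¹ • y, mem_sphere_zero_iff_norm.mpr (norm_smul_inv_norm (𝕜 := ℝ) h)⟩
  else 0

/-- The Cartesian partial derivative `∂_i` at a point of `S²` of the radially constant extension. -/
def partialDeriv (i : Fin 3) (f : S2 → ℝ) (x : S2) : ℝ :=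
  fderiv ℝ (radialExt f) (x : E3) (EuclideanSpace.single i 1)

/-- The round metric `σ_AB`, that is, the projection onto the tangent plane at `x`. -/
def metric (x : S2) (i j : Fin 3) : ℝ :=
  (if i = j then 1 else 0) - (x : E3) i * (x : E3) j

/-- The area form `ε_AB` of the round metric, `ε(v, w) = det (x, v, w)` (outward orientation). -/
def areaForm (x : S2) (i j : Fin 3) : ℝ :=
  Matrix.det (Matrix.of ![fun k => (x : E3) k, Pi.single i 1, Pi.single j 1])

/-- `∇_A f` for a function `f`. -/
def grad (f : S2 → ℝ) (x : S2) (i : Fin 3) : ℝ :=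
  ∑ a, metric x i a * partialDeriv a f x

/-- `∇_A w_B` for a one-form `w` (first index: direction of differentiation): the Levi-Civita
connection of the round metric is the tangential projection of the Euclidean derivative. -/
def covD1 (w : S2 → Fin 3 → ℝ) (x : S2) (i j : Fin 3) : ℝ :=
  ∑ a, ∑ b, metric x i a * metric x j b * partialDeriv a (fun y => w y b) x

/-- `∇_A T_BC` for a 2-tensor `T` (first index: direction of differentiation). -/
def covD2 (T : S2 → Fin 3 → Fin 3 → ℝ) (x : S2) (i j k : Fin 3) : ℝ :=
  ∑ a, ∑ b, ∑ c, metric x i a * metric x j b * metric x k c *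
    partialDeriv a (fun y => T y b c) x

/-- The Hessian `∇_A ∇_B f`. -/
def hess (f : S2 → ℝ) : S2 → Fin 3 → Fin 3 → ℝ := covD1 (grad f)

/-- The Laplacian `Δ f = ∇^A ∇_A f`. -/
def lap (f : S2 → ℝ) (x : S2) : ℝ := ∑ i, hess f x i i

/-- The divergence `∇^A w_A` of a one-form. -/
def div1 (w : S2 → Fin 3 → ℝ) (x : S2) : ℝ := ∑ i, covD1 w x i i

/-- The divergence `∇^B T_BA` of a 2-tensor in its first index. -/
def div2 (T : S2 → Fin 3 → Fin 3 → ℝ) (x : S2) (j : Fin 3) : ℝ := ∑ i, covD2 T x i i j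

/-- The inner product `S_AB T^AB` of two 2-tensors. -/
def inner2 (S T : S2 → Fin 3 → Fin 3 → ℝ) (x : S2) : ℝ := ∑ i, ∑ j, S x i j * T x i j

/-- The standard coordinate function `X^k` of `ℝ³` restricted to `S²`. -/
def coord (k : Fin 3) (x : S2) : ℝ := (x : E3) k

/-- One-forms on `S²`: tangential fields of covectors. -/
def IsOneForm (w : S2 → Fin 3 → ℝ) : Prop :=
  ∀ x : S2, ∑ i, (x : E3) i * w x i = 0

/-- Symmetric traceless (tangential) 2-tensors on `S²`. -/
def IsSymTraceless (T : S2 → Fin 3 → Fin 3 → ℝ) : Prop :=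
  ∀ x : S2, (∀ j, ∑ i, (x : E3) i * T x i j = 0) ∧ (∀ i j, T x i j = T x j i) ∧ ∑ i, T x i i = 0

/-- The duality map `ε₂(C)_AB = ε_A^D C_DB`. -/
def eps2 (T : S2 → Fin 3 → Fin 3 → ℝ) (x : S2) (i j : Fin 3) : ℝ :=
  ∑ d, areaForm x i d * T x d j

/-- The functions `c` and `cb` (smooth) are potentials of the 2-tensor `T`:
`T_AB = ∇_A∇_B c - ½ σ_AB Δc + ½ (ε_A^E ∇_E∇_B cb + ε_B^E ∇_E∇_A cb)`. -/
def IsPotentials (T : S2 → Fin 3 → Fin 3 → ℝ) (c cb : S2 → ℝ) : Prop :=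
  ContMDiff (𝓡 2) 𝓘(ℝ, ℝ) ∞ c ∧ ContMDiff (𝓡 2) 𝓘(ℝ, ℝ) ∞ cb ∧
  ∀ x i j, T x i j = hess c x i j - 1 / 2 * metric x i j * lap c x
    + 1 / 2 * (∑ e, areaForm x i e * hess cb x e j + ∑ e, areaForm x j e * hess cb x e i)

/-! ### Null infinity data -/

/-- Fields on null infinity as functions of the retarded time and of the point of `S²`:
the mass aspect `m`, the angular momentum aspect `N_A`, the shear `C_AB` and the news `N_AB`. -/
structure Fields where
  mass : ℝ → S2 → ℝ
  angMom : ℝ → S2 → Fin 3 → ℝ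
  shear : ℝ → S2 → Fin 3 → Fin 3 → ℝ
  news : ℝ → S2 → Fin 3 → Fin 3 → ℝ

/-- Joint smoothness on `[u₁, u₂] × S²`. -/
def SmoothOn {F : Type*} [NormedAddCommGroup F] [NormedSpace ℝ F] (u₁ u₂ : ℝ)
    (f : ℝ → S2 → F) : Prop :=
  ContMDiffOn (𝓘(ℝ, ℝ).prod (𝓡 2)) 𝓘(ℝ, F) ∞ (fun p : ℝ × S2 => f p.1 p.2)
    (Set.Icc u₁ u₂ ×ˢ Set.univ)

/-- The right-hand side `¼ ∇^A ∇^B N_AB - ⅛ N_AB N^AB` of the evolution equation of `m`. -/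
def massRHS (N : S2 → Fin 3 → Fin 3 → ℝ) (x : S2) : ℝ :=
  1 / 4 * div1 (div2 N) x - 1 / 8 * inner2 N N x

/-- The right-hand side of the evolution equation of the angular momentum aspect,
`∇_A m - ¼ ∇^D (∇_D ∇^E C_EA - ∇_A ∇^E C_ED) + ¼ ∇_A (C_BE N^BE) - ¼ ∇_B (C^BD N_DA)
  + ½ C_AB ∇_D N^DB`. -/
def angMomRHS (m : S2 → ℝ) (C N : S2 → Fin 3 → Fin 3 → ℝ) (x : S2) (i : Fin 3) : ℝ :=
  grad m x i
  - 1 / 4 * div2 (fun y d a => covD1 (div2 C) y d a - covD1 (div2 C) y a d) x i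
  + 1 / 4 * grad (inner2 C N) x i
  - 1 / 4 * div2 (fun y b a => ∑ d, C y b d * N y d a) x i
  + 1 / 2 * ∑ b, C x i b * div2 N x b

/-- Null infinity data on `[u₁, u₂] × S²`: smooth fields of the right tensor types with
`∂_u C_AB = N_AB` that satisfy the evolution equations of the mass aspect and of the angular
momentum aspect (one-sided derivatives in `u` at the end points). -/
structure IsNullInfinityData (u₁ u₂ : ℝ) (D : Fields) : Prop where
  smooth_mass : SmoothOn u₁ u₂ D.mass
  smooth_angMom : SmoothOn u₁ u₂ D.angMom
  smooth_shear : SmoothOn u₁ u₂ D.shear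
  smooth_news : SmoothOn u₁ u₂ D.news
  oneForm_angMom : ∀ u ∈ Set.Icc u₁ u₂, IsOneForm (D.angMom u)
  symTraceless_shear : ∀ u ∈ Set.Icc u₁ u₂, IsSymTraceless (D.shear u)
  symTraceless_news : ∀ u ∈ Set.Icc u₁ u₂, IsSymTraceless (D.news u)
  deriv_shear : ∀ u ∈ Set.Icc u₁ u₂, ∀ x i j,
    HasDerivWithinAt (fun v => D.shear v x i j) (D.news u x i j) (Set.Icc u₁ u₂) u
  deriv_mass : ∀ u ∈ Set.Icc u₁ u₂, ∀ x,
    HasDerivWithinAt (fun v => D.mass v x) (massRHS (D.news u) x) (Set.Icc u₁ u₂) u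
  deriv_angMom : ∀ u ∈ Set.Icc u₁ u₂, ∀ x i,
    HasDerivWithinAt (fun v => D.angMom v x i)
      (angMomRHS (D.mass u) (D.shear u) (D.news u) x i) (Set.Icc u₁ u₂) u

/-- `D'` is the dual of `D` on `[u₁, u₂]`: null infinity data (in particular a solution of
the evolution equations) with shear `ε₂(C)` and with the same mass aspect and angular momentum
aspect as `D` at the initial time `u₁`. -/
structure IsDualData (u₁ u₂ : ℝ) (D D' : Fields) : Prop where
  isData : IsNullInfinityData u₁ u₂ D'
  shear_eq : ∀ u ∈ Set.Icc u₁ u₂, D'.shear u = eps2 (D.shear u)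
  mass_init : D'.mass u₁ = D.mass u₁
  angMom_init : D'.angMom u₁ = D.angMom u₁

/-- Two sets of fields coincide on `[u₁, u₂] × S²`. -/
def AgreeOn (u₁ u₂ : ℝ) (D D' : Fields) : Prop :=
  ∀ u ∈ Set.Icc u₁ u₂, D'.mass u = D.mass u ∧ D'.angMom u = D.angMom u ∧
    D'.shear u = D.shear u ∧ D'.news u = D.news u

/-! ### Classical conserved quantities at retarded time `u` -/

/-- The energy `E = ∫ 2m`. -/
def energy (D : Fields) (u : ℝ) : ℝ := sphereIntegral fun x => 2 * D.mass u x

/-- The linear momentum `P^k = ∫ 2m X^k`. -/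
def linearMomentum (D : Fields) (u : ℝ) (k : Fin 3) : ℝ :=
  sphereIntegral fun x => 2 * D.mass u x * coord k x

/-- The one-form `N_A - ¼ C_A^D ∇^B C_DB`. -/
def correctedAspect (D : Fields) (u : ℝ) (x : S2) (i : Fin 3) : ℝ :=
  D.angMom u x i
    - 1 / 4 * ∑ d, D.shear u x i d * ∑ b, covD2 (D.shear u) x b d b

/-- The classical angular momentum
`J^k = ∫ ε^AB ∇_B X^k [N_A - ¼ C_A^D ∇^B C_DB]`. -/
def angularMomentum (D : Fields) (u : ℝ) (k : Fin 3) : ℝ :=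
  sphereIntegral fun x =>
    ∑ i, (∑ j, areaForm x i j * grad (coord k) x j) * correctedAspect D u x i

/-- The classical center of mass
`C^k = ∫ ∇^A X^k [N_A - u ∇_A m - ¼ C_A^D ∇^B C_DB - (1/16) ∇_A (C_DE C^DE)]`. -/
def centerOfMass (D : Fields) (u : ℝ) (k : Fin 3) : ℝ :=
  sphereIntegral fun x =>
    ∑ i, grad (coord k) x i *
      (correctedAspect D u x i - u * grad (D.mass u) x i
        - 1 / 16 * grad (inner2 (D.shear u) (D.shear u)) x i)

end NullInfinity

end

/-!
A dual set of data has news `ε₂(N)`, since `∂_u` commutes with `ε₂`, and its mass and angular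
momentum aspects are then two successive quadratures in `u`; this gives existence and uniqueness.

The right-hand sides of the evolution equations depend on the duality only through linear terms.
Indeed `ε₂` rotates the first index of a symmetric traceless tensor by a right angle, it commutes
with the divergence up to the same rotation, and the rotations cancel in every quadratic term.
The linear terms do not contribute to the charges. For the mass this is an integration by parts
against `1` and `X^k`, whose Hessians are pure trace. For the angular momentum aspect one pairs
with the conformal field `∇X^k` and the Killing field `ε∇X^k`: the remaining term is the
divergence of an antisymmetric tensor `curl (div C)`, which is orthogonal to the first and equals,
up to a factor, the pairing of `div C` with the second, which vanishes as `C` is symmetric.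

A symmetric traceless tensor with potentials `(c, c̲)` is `H c + ε₂ (H c̲)` with `H` the traceless
Hessian, so the potentials of its dual follow from `ε₂² = -1`.
-/

noncomputable section

namespace NullInfinity

open scoped Manifold ContDiff Topology
open Set MeasureTheory

/-! ### Smooth functions on the sphere -/

section Smooth
variable {F : Type*} [NormedAddCommGroup F] [NormedSpace ℝ F] {u₁ u₂ : ℝ}

instance finrank_E3 : Fact (Module.finrank ℝ E3 = 2 + 1) := ⟨by simp⟩

/-- Smoothness of a vector-valued function on the sphere; in Cartesian components this covers
functions, one-forms and 2-tensors alike. -/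
abbrev Smooth (f : S2 → F) : Prop := ContMDiff (𝓡 2) 𝓘(ℝ, F) ∞ f

/-- The radial retraction `y ↦ y / ‖y‖` of `ℝ³ \ {0}` onto the sphere, with a junk value at the
origin. Off the origin, `f ∘ retraction` is the radially constant extension of `f`. -/
def retraction (y : E3) : S2 :=
  open Classical in
  if h : y ≠ 0 then ⟨‖y‖⁻¹ • y, mem_sphere_zero_iff_norm.mpr (norm_smul_inv_norm (𝕜 := ℝ) h)⟩
  else ⟨EuclideanSpace.single 0 1, by simp⟩

lemma coe_retraction {y : E3} (hy : y ≠ 0) : (retraction y : E3) = ‖y‖⁻¹ • y := by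
  simp [retraction, hy]

lemma retraction_coe (x : S2) : retraction x = x :=
  Subtype.ext <| by simp [coe_retraction (ne_zero_of_mem_unit_sphere x)]

lemma retraction_smul {c : ℝ} (hc : 0 < c) (y : E3) : retraction (c • y) = retraction y := by
  rcases eq_or_ne y 0 with rfl | hy
  · rw [smul_zero]
  · apply Subtype.ext
    rw [coe_retraction (smul_ne_zero hc.ne' hy), coe_retraction hy, norm_smul, smul_smul,
      Real.norm_of_nonneg hc.le]
    congr 1
    field_simp

lemma contMDiffAt_retraction {y : E3} (hy : y ≠ 0) :
    ContMDiffAt 𝓘(ℝ, E3) (𝓡 2) ∞ retraction y := by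
  let U : TopologicalSpace.Opens E3 := ⟨{0}ᶜ, isOpen_compl_singleton⟩
  have normalize : ContMDiff 𝓘(ℝ, E3) 𝓘(ℝ, E3) ∞ (fun z : U => ‖(z : E3)‖⁻¹ • (z : E3)) := by
    intro z
    have hz : (z : E3) ≠ 0 := z.2
    have : ContDiffAt ℝ ∞ (fun z : E3 => ‖z‖⁻¹ • z) z :=
      ((contDiffAt_norm ℝ hz).inv (norm_ne_zero_iff.mpr hz)).smul contDiffAt_id
    exact (contMDiffAt_subtype_iff (f := fun z : E3 => ‖z‖⁻¹ • z)).mpr this.contMDiffAt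
  have restricted : ContMDiff 𝓘(ℝ, E3) (𝓡 2) ∞ (fun z : U => retraction (z : E3)) :=
    (normalize.codRestrict_sphere (n := 2)
      (fun z => mem_sphere_zero_iff_norm.mpr (norm_smul_inv_norm (𝕜 := ℝ) z.2))).congr
      fun z => Subtype.ext (coe_retraction z.2)
  exact (contMDiffAt_subtype_iff (U := U) (f := retraction) (x := ⟨y, hy⟩)).mp (restricted _)

lemma SmoothOn.contDiffOn {f : ℝ → S2 → F} (hf : SmoothOn u₁ u₂ f) :
    ContDiffOn ℝ ∞ (fun p : ℝ × E3 => f p.1 (retraction p.2)) (Icc u₁ u₂ ×ˢ {0}ᶜ) := by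
  rw [← contMDiffOn_iff_contDiffOn]
  have : ContMDiffOn 𝓘(ℝ, ℝ × E3) (𝓘(ℝ, ℝ).prod (𝓡 2)) ∞
      (fun p : ℝ × E3 => (p.1, retraction p.2)) (Icc u₁ u₂ ×ˢ {0}ᶜ) :=
    contDiff_fst.contMDiff.contMDiffOn.prodMk fun p hp =>
      ((contMDiffAt_retraction hp.2).comp p
        contDiff_snd.contMDiff.contMDiffAt).contMDiffWithinAt
  exact ContMDiffOn.comp hf this fun p hp => ⟨hp.1, trivial⟩

lemma SmoothOn.of_contDiffOn {f : ℝ → S2 → F} {H : ℝ × E3 → F}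
    (hH : ContDiffOn ℝ ∞ H (Icc u₁ u₂ ×ˢ {0}ᶜ))
    (h : ∀ u ∈ Icc u₁ u₂, ∀ x : S2, f u x = H (u, x)) : SmoothOn u₁ u₂ f := by
  have : ContMDiff (𝓘(ℝ, ℝ).prod (𝓡 2)) 𝓘(ℝ, ℝ × E3) ∞
      (fun p : ℝ × S2 => (p.1, (p.2 : E3))) :=
    contMDiff_fst.prodMk_space ((contMDiff_coe_sphere (n := 2)).comp contMDiff_snd)
  exact ((contMDiffOn_iff_contDiffOn.mpr hH).comp this.contMDiffOn (s := Icc u₁ u₂ ×ˢ univ)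
    (fun p hp => ⟨hp.1, ne_zero_of_mem_unit_sphere p.2⟩)).congr fun p hp => h _ hp.1 _

lemma SmoothOn.smooth {f : ℝ → S2 → F} (hf : SmoothOn u₁ u₂ f) {u : ℝ}
    (hu : u ∈ Icc u₁ u₂) : Smooth (f u) := by
  have : ContMDiff (𝓡 2) (𝓘(ℝ, ℝ).prod (𝓡 2)) ∞ (fun x : S2 => (u, x)) :=
    contMDiff_const.prodMk contMDiff_id
  have := ContMDiffOn.comp hf this.contMDiffOn (s := univ) (fun _ _ => ⟨hu, trivial⟩)
  rwa [contMDiffOn_univ] at this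

lemma Smooth.smoothOn {f : S2 → F} (hf : Smooth f) (u₁ u₂ : ℝ) : SmoothOn u₁ u₂ (fun _ => f) :=
  (hf.comp contMDiff_snd).contMDiffOn

lemma Smooth.of_smoothOn {f : S2 → F} (hf : SmoothOn 0 1 (fun _ => f)) : Smooth f :=
  hf.smooth (left_mem_Icc.mpr zero_le_one)

lemma Smooth.contDiffAt {f : S2 → F} (hf : Smooth f) {y : E3} (hy : y ≠ 0) :
    ContDiffAt ℝ ∞ (f ∘ retraction) y :=
  contMDiffAt_iff_contDiffAt.mp (ContMDiffAt.comp y (hf _) (contMDiffAt_retraction hy))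

lemma Smooth.differentiableAt {f : S2 → F} (hf : Smooth f) (x : S2) :
    DifferentiableAt ℝ (f ∘ retraction) (x : E3) :=
  (hf.contDiffAt (ne_zero_of_mem_unit_sphere x)).differentiableAt (by simp)

lemma smooth_const (c : F) : Smooth (fun _ => c) := contMDiff_const

lemma smooth_coord (k : Fin 3) : Smooth (coord k) :=
  .of_smoothOn <| .of_contDiffOn (H := fun p => p.2 k) (by fun_prop) fun _ _ _ => rfl

end Smooth

section Closure
variable {u₁ u₂ : ℝ}

lemma SmoothOn.add {f g : ℝ → S2 → ℝ} (hf : SmoothOn u₁ u₂ f) (hg : SmoothOn u₁ u₂ g) :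
    SmoothOn u₁ u₂ (fun u x => f u x + g u x) := ContMDiffOn.add hf hg

lemma SmoothOn.sub {f g : ℝ → S2 → ℝ} (hf : SmoothOn u₁ u₂ f) (hg : SmoothOn u₁ u₂ g) :
    SmoothOn u₁ u₂ (fun u x => f u x - g u x) := ContMDiffOn.sub hf hg

lemma SmoothOn.mul {f g : ℝ → S2 → ℝ} (hf : SmoothOn u₁ u₂ f) (hg : SmoothOn u₁ u₂ g) :
    SmoothOn u₁ u₂ (fun u x => f u x * g u x) := ContMDiffOn.mul hf hg

lemma SmoothOn.const_mul {f : ℝ → S2 → ℝ} (c : ℝ) (hf : SmoothOn u₁ u₂ f) :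
    SmoothOn u₁ u₂ (fun u x => c * f u x) := ((smooth_const c).smoothOn u₁ u₂).mul hf

lemma SmoothOn.sum {ι : Type*} {s : Finset ι} {f : ι → ℝ → S2 → ℝ}
    (hf : ∀ i ∈ s, SmoothOn u₁ u₂ (f i)) : SmoothOn u₁ u₂ (fun u x => ∑ i ∈ s, f i u x) :=
  contMDiffOn_finsetSum hf

lemma smoothOn_pi {ι : Type*} [Fintype ι] {F : ι → Type*} [∀ i, NormedAddCommGroup (F i)]
    [∀ i, NormedSpace ℝ (F i)] {w : ℝ → S2 → (i : ι) → F i} :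
    SmoothOn u₁ u₂ w ↔ ∀ i, SmoothOn u₁ u₂ (fun u x => w u x i) :=
  contMDiffOn_pi_space

lemma smoothOn_pi₂ {w : ℝ → S2 → Fin 3 → Fin 3 → ℝ} :
    SmoothOn u₁ u₂ w ↔ ∀ i j, SmoothOn u₁ u₂ (fun u x => w u x i j) := by
  simp only [smoothOn_pi]

lemma Smooth.sub {f g : S2 → ℝ} (hf : Smooth f) (hg : Smooth g) :
    Smooth (fun x => f x - g x) := ContMDiff.sub hf hg

lemma Smooth.mul {f g : S2 → ℝ} (hf : Smooth f) (hg : Smooth g) :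
    Smooth (fun x => f x * g x) := ContMDiff.mul hf hg

lemma Smooth.const_mul {f : S2 → ℝ} (c : ℝ) (hf : Smooth f) : Smooth (fun x => c * f x) :=
  (smooth_const c).mul hf

lemma Smooth.sum {ι : Type*} {s : Finset ι} {f : ι → S2 → ℝ} (hf : ∀ i ∈ s, Smooth (f i)) :
    Smooth (fun x => ∑ i ∈ s, f i x) :=
  contMDiff_finsetSum hf

lemma smooth_pi {ι : Type*} [Fintype ι] {F : ι → Type*} [∀ i, NormedAddCommGroup (F i)]
    [∀ i, NormedSpace ℝ (F i)] {w : S2 → (i : ι) → F i} :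
    Smooth w ↔ ∀ i, Smooth (fun x => w x i) :=
  contMDiff_pi_space

lemma smooth_pi₂ {T : S2 → Fin 3 → Fin 3 → ℝ} :
    Smooth T ↔ ∀ i j, Smooth (fun x => T x i j) := by
  simp only [smooth_pi]

end Closure

/-! ### Cartesian partial derivatives -/

section PartialDeriv
variable {f g : S2 → ℝ}

lemma radialExt_eq (f : S2 → ℝ) {y : E3} (hy : y ≠ 0) : radialExt f y = f (retraction y) := by
  simp [radialExt, retraction, hy]

lemma eventuallyEq_of_eqOn_compl_zero {β : Type*} {F G : E3 → β} (h : ∀ y ≠ 0, F y = G y)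
    (x : S2) : F =ᶠ[𝓝 (x : E3)] G :=
  Filter.eventuallyEq_of_mem (isOpen_compl_singleton.mem_nhds (ne_zero_of_mem_unit_sphere x)) h

lemma partialDeriv_eq_fderiv (a : Fin 3) (f : S2 → ℝ) (x : S2) :
    partialDeriv a f x = fderiv ℝ (f ∘ retraction) x (EuclideanSpace.single a 1) := by
  rw [partialDeriv, (eventuallyEq_of_eqOn_compl_zero (fun _ => radialExt_eq f) x).fderiv_eq]; rfl

lemma partialDeriv_mul (a : Fin 3) (hf : Smooth f) (hg : Smooth g) (x : S2) :
    partialDeriv a (fun y => f y * g y) x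
      = partialDeriv a f x * g x + f x * partialDeriv a g x := by
  simp only [partialDeriv_eq_fderiv]
  have := DFunLike.congr_fun (fderiv_mul (hf.differentiableAt x) (hg.differentiableAt x))
    (EuclideanSpace.single a 1)
  simp only [Function.comp_apply, retraction_coe, add_apply,
    smul_apply, smul_eq_mul] at this
  exact this.trans (by ring)

lemma partialDeriv_const (a : Fin 3) (c : ℝ) (x : S2) : partialDeriv a (fun _ => c) x = 0 := by
  rw [partialDeriv_eq_fderiv]
  exact DFunLike.congr_fun (fderiv_const_apply c) _

lemma partialDeriv_const_mul (a : Fin 3) (c : ℝ) (hf : Smooth f) (x : S2) :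
    partialDeriv a (fun y => c * f y) x = c * partialDeriv a f x := by
  rw [partialDeriv_mul a (smooth_const c) hf, partialDeriv_const, zero_mul, zero_add]

lemma partialDeriv_neg (a : Fin 3) (f : S2 → ℝ) (x : S2) :
    partialDeriv a (-f) x = - partialDeriv a f x := by
  simp only [partialDeriv_eq_fderiv]
  exact DFunLike.congr_fun (fderiv_neg (f := f ∘ retraction)) _

lemma partialDeriv_sub (a : Fin 3) (hf : Smooth f) (hg : Smooth g) (x : S2) :
    partialDeriv a (fun y => f y - g y) x = partialDeriv a f x - partialDeriv a g x := by
  simp only [partialDeriv_eq_fderiv]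
  exact DFunLike.congr_fun (fderiv_sub (hf.differentiableAt x) (hg.differentiableAt x)) _

lemma partialDeriv_sum {ι : Type*} (s : Finset ι) (a : Fin 3) {f : ι → S2 → ℝ}
    (hf : ∀ i ∈ s, Smooth (f i)) (x : S2) :
    partialDeriv a (fun y => ∑ i ∈ s, f i y) x = ∑ i ∈ s, partialDeriv a (f i) x := by
  simp only [partialDeriv_eq_fderiv]
  exact (DFunLike.congr_fun (fderiv_fun_sum fun i hi => (hf i hi).differentiableAt x) _).trans
    (by simp)

lemma sum_coord_sq (x : S2) : ∑ a, (x : E3) a * (x : E3) a = 1 := by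
  simpa [sq] using (EuclideanSpace.norm_sq_eq (x : E3)).symm

lemma sum_smul_single {ι : Type*} [Fintype ι] [DecidableEq ι] (y : EuclideanSpace ℝ ι) :
    ∑ a, y a • EuclideanSpace.single a (1 : ℝ) = y := by
  simpa using (EuclideanSpace.basisFun ι ℝ).sum_repr y

lemma fderiv_comp_retraction_smul (hf : Smooth f) {c : ℝ} (hc : 0 < c) {y : E3} (hy : y ≠ 0) :
    c • fderiv ℝ (f ∘ retraction) (c • y) = fderiv ℝ (f ∘ retraction) y := by
  have scale : HasFDerivAt (fun z : E3 => c • z) (c • ContinuousLinearMap.id ℝ E3) y :=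
    (hasFDerivAt_id y).const_smul c
  have chain := ((hf.contDiffAt (smul_ne_zero hc.ne' hy)).differentiableAt
    (by simp)).hasFDerivAt.comp y scale
  have : (f ∘ retraction) ∘ (fun z : E3 => c • z) = f ∘ retraction :=
    funext fun z => congrArg f (retraction_smul hc z)
  rw [this] at chain
  ext v
  simp [chain.fderiv]

lemma sum_coord_mul_partialDeriv (hf : Smooth f) (x : S2) :
    ∑ a, (x : E3) a * partialDeriv a f x = 0 := by
  have ray : HasDerivAt (fun t : ℝ => t • (x : E3)) ((1 : ℝ) • (x : E3)) 1 :=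
    (hasDerivAt_id (1 : ℝ)).smul_const _
  have chain := (hf.differentiableAt x).hasFDerivAt.comp_hasDerivAt_of_eq (1 : ℝ) ray (by simp)
  have const : ((f ∘ retraction) ∘ fun t : ℝ => t • (x : E3)) =ᶠ[𝓝 1] fun _ => f x := by
    filter_upwards [Ioi_mem_nhds (zero_lt_one' ℝ)] with t ht
    exact congrArg f ((retraction_smul ht _).trans (retraction_coe x))
  have radial : fderiv ℝ (f ∘ retraction) x x = 0 := by
    simpa using (chain.congr_of_eventuallyEq const.symm).unique (hasDerivAt_const (1 : ℝ) (f x))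
  have := congrArg (fderiv ℝ (f ∘ retraction) x) (sum_smul_single (x : E3))
  simpa only [map_sum, map_smul, smul_eq_mul, ← partialDeriv_eq_fderiv, radial] using this

lemma hasFDerivAt_norm {E : Type*} [NormedAddCommGroup E] [InnerProductSpace ℝ E] {y : E}
    (hy : y ≠ 0) : HasFDerivAt (fun z : E => ‖z‖) (‖y‖⁻¹ • innerSL ℝ y) y := by
  have h := (hasStrictFDerivAt_norm_sq y).hasFDerivAt.sqrt (by simpa using hy)
  simp only [Real.sqrt_sq (norm_nonneg _)] at h
  refine h.congr_fderiv ?_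
  ext v
  simp only [smul_apply, nsmul_eq_mul, smul_eq_mul, Nat.cast_ofNat]
  field_simp

lemma partialDeriv_coord (a b : Fin 3) (x : S2) : partialDeriv a (coord b) x = metric x a b := by
  have hx := ne_zero_of_mem_unit_sphere x
  have formula : coord b ∘ retraction =ᶠ[𝓝 (x : E3)] fun y => ‖y‖⁻¹ * y b :=
    eventuallyEq_of_eqOn_compl_zero (fun y hy => by simp [coord, coe_retraction hy]) x
  have proj : HasFDerivAt (fun y : E3 => y b) (EuclideanSpace.proj b : E3 →L[ℝ] ℝ) x :=
    (EuclideanSpace.proj b : E3 →L[ℝ] ℝ).hasFDerivAt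
  have inv := (hasDerivAt_inv (norm_ne_zero_iff.mpr hx)).comp_hasFDerivAt (x : E3)
    (hasFDerivAt_norm hx)
  rw [partialDeriv_eq_fderiv, ((inv.mul proj).congr_of_eventuallyEq formula).fderiv, metric]
  simp [eq_comm, EuclideanSpace.inner_single_right]
  ring

lemma smooth_partialDeriv (a : Fin 3) (hf : Smooth f) : Smooth (partialDeriv a f) := by
  refine .of_smoothOn <| .of_contDiffOn (H := fun p =>
    fderiv ℝ (f ∘ retraction) p.2 (EuclideanSpace.single a 1)) ?_
    fun _ _ x => partialDeriv_eq_fderiv a f x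
  intro p hp
  have : ContDiffAt ℝ ∞ (fun y => fderiv ℝ (f ∘ retraction) y (EuclideanSpace.single a 1)) p.2 :=
    ((hf.contDiffAt hp.2).fderiv_right (m := ∞) (by simp)).clm_apply contDiffAt_const
  exact (this.comp p contDiffAt_snd).contDiffWithinAt

/-- The factor `‖y‖` appears because a derivative of a degree-zero homogeneous function is
homogeneous of degree `-1`. -/
lemma partialDeriv_retraction (b : Fin 3) (hf : Smooth f) {y : E3} (hy : y ≠ 0) :
    partialDeriv b f (retraction y)
      = ‖y‖ * fderiv ℝ (f ∘ retraction) y (EuclideanSpace.single b 1) := by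
  rw [partialDeriv_eq_fderiv, coe_retraction hy,
    ← fderiv_comp_retraction_smul hf (inv_pos.mpr (norm_pos_iff.mpr hy)) hy]
  simp [hy]

lemma partialDeriv_partialDeriv (a b : Fin 3) (hf : Smooth f) (x : S2) :
    partialDeriv a (partialDeriv b f) x = (x : E3) a * partialDeriv b f x
      + fderiv ℝ (fderiv ℝ (f ∘ retraction)) x (EuclideanSpace.single a 1)
          (EuclideanSpace.single b 1) := by
  have hx := ne_zero_of_mem_unit_sphere x
  have formula : partialDeriv b f ∘ retraction =ᶠ[𝓝 (x : E3)] fun y =>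
      ‖y‖ * fderiv ℝ (f ∘ retraction) y (EuclideanSpace.single b 1) :=
    eventuallyEq_of_eqOn_compl_zero (fun _ => partialDeriv_retraction b hf) x
  have second : DifferentiableAt ℝ (fderiv ℝ (f ∘ retraction)) x :=
    ((hf.contDiffAt hx).fderiv_right (m := ∞) (by simp)).differentiableAt (by simp)
  have product := (hasFDerivAt_norm hx).mul
    (second.hasFDerivAt.clm_apply (hasFDerivAt_const (EuclideanSpace.single b (1 : ℝ)) (x : E3)))
  rw [partialDeriv_eq_fderiv, (product.congr_of_eventuallyEq formula).fderiv,
    partialDeriv_eq_fderiv]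
  simp [EuclideanSpace.inner_single_right]
  ring

lemma partialDeriv_comm (a b : Fin 3) (hf : Smooth f) (x : S2) :
    partialDeriv a (partialDeriv b f) x - partialDeriv b (partialDeriv a f) x
      = (x : E3) a * partialDeriv b f x - (x : E3) b * partialDeriv a f x := by
  have le : minSmoothness ℝ 2 ≤ (∞ : ℕ∞ω) := by
    rw [minSmoothness_of_isRCLikeNormedField]
    exact WithTop.coe_le_coe.mpr le_top
  have symm : IsSymmSndFDerivAt ℝ (f ∘ retraction) (x : E3) :=
    (hf.contDiffAt (ne_zero_of_mem_unit_sphere x)).isSymmSndFDerivAt le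
  rw [partialDeriv_partialDeriv a b hf, partialDeriv_partialDeriv b a hf, symm.eq]
  ring

end PartialDeriv

/-! ### Time-dependent functions -/

section TimePrimitive

universe w
variable {E G : Type*} {a b : ℝ} {U : Set E}

lemma continuousOn_slice [TopologicalSpace E] [TopologicalSpace G] {F : ℝ × E → G}
    (hF : ContinuousOn F (Icc a b ×ˢ U)) {y : E} (hy : y ∈ U) :
    ContinuousOn (fun v => F (v, y)) (Icc a b) :=
  hF.comp (by fun_prop) (fun _ hv => ⟨hv, hy⟩)

lemma intervalIntegrable_slice [TopologicalSpace E] [NormedAddCommGroup G] {F : ℝ × E → G}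
    (hF : ContinuousOn F (Icc a b ×ˢ U)) {y : E} (hy : y ∈ U)
    {s t : ℝ} (hs : s ∈ Icc a b) (ht : t ∈ Icc a b) :
    IntervalIntegrable (fun v => F (v, y)) volume s t :=
  ((continuousOn_slice hF hy).mono (uIcc_subset_Icc hs ht)).intervalIntegrable

variable [NormedAddCommGroup G] [NormedSpace ℝ G]

/-- The primitive in the first variable, with base point `a`, of a function of two variables. -/
def timePrimitive (a : ℝ) (F : ℝ × E → G) (p : ℝ × E) : G := ∫ v in a..p.1, F (v, p.2)

lemma continuousOn_timePrimitive [TopologicalSpace E] {F : ℝ × E → G} (hab : a ≤ b)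
    (hF : ContinuousOn F (Icc a b ×ˢ U)) :
    ContinuousOn (timePrimitive a F) (Icc a b ×ˢ U) := by
  rw [continuousOn_iff_continuous_domRestrict] at hF ⊢
  let f : ↥(Icc a b ×ˢ U) → ℝ → G := fun p t =>
    (Icc a b ×ˢ U).domRestrict F ⟨((projIcc a b hab t : ℝ), p.1.2), ⟨(projIcc a b hab t).2, p.2.2⟩⟩
  have hf : Continuous (Function.uncurry f) := by
    refine hF.comp (Continuous.subtype_mk ?_ _)
    exact (continuous_subtype_val.comp (continuous_projIcc.comp continuous_snd)).prodMk
      (continuous_snd.comp (continuous_subtype_val.comp continuous_fst))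
  have clamped := intervalIntegral.continuous_parametric_intervalIntegral_of_continuous
    (μ := volume) (a₀ := a) hf (s := fun p => p.1.1) (continuous_fst.comp continuous_subtype_val)
  refine clamped.congr fun p => intervalIntegral.integral_congr fun t ht => ?_
  have ht' : t ∈ Icc a b := uIcc_subset_Icc ⟨le_rfl, hab⟩ p.2.1 ht
  simp [f, projIcc_of_mem hab ht']

variable [NormedAddCommGroup E] [NormedSpace ℝ E]

lemma hasFDerivWithinAt_integral_endpoint [CompleteSpace G] {F : ℝ × E → G}
    (hF : ContinuousOn F (Icc a b ×ˢ U)) {u : ℝ} {y : E} (hu : u ∈ Icc a b) (hy : y ∈ U) :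
    HasFDerivWithinAt (fun p : ℝ × E => ∫ v in u..p.1, F (v, p.2))
      ((ContinuousLinearMap.fst ℝ ℝ E).smulRight (F (u, y))) (Icc a b ×ˢ U) (u, y) := by
  rw [hasFDerivWithinAt_iff_isLittleO, Asymptotics.isLittleO_iff]
  intro ε hε
  obtain ⟨δ, hδ, hball⟩ := Metric.continuousWithinAt_iff.mp (hF (u, y) ⟨hu, hy⟩) ε hε
  filter_upwards [inter_mem_nhdsWithin _ (Metric.ball_mem_nhds (u, y) hδ)] with p hp
  obtain ⟨⟨hp1, hp2⟩, hpb⟩ := hp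
  have hpu : |p.1 - u| < δ := (le_max_left _ _).trans_lt hpb
  have hpy : dist p.2 y < δ := (le_max_right _ _).trans_lt hpb
  have remainder : (∫ v in u..p.1, F (v, p.2)) - (∫ v in u..u, F (v, y))
      - ((ContinuousLinearMap.fst ℝ ℝ E).smulRight (F (u, y))) (p - (u, y))
      = ∫ v in u..p.1, (F (v, p.2) - F (u, y)) := by
    rw [intervalIntegral.integral_sub (intervalIntegrable_slice hF hp2 hu hp1)
      intervalIntegrable_const]
    simp
  have bound : ∀ v ∈ uIoc u p.1, ‖F (v, p.2) - F (u, y)‖ ≤ ε := by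
    intro v hv
    rw [← dist_eq_norm]
    refine (hball (x := (v, p.2)) ⟨uIcc_subset_Icc hu hp1 (uIoc_subset_uIcc hv), hp2⟩ ?_).le
    exact max_lt ((abs_sub_left_of_mem_uIcc (uIoc_subset_uIcc hv)).trans_lt hpu) hpy
  rw [remainder]
  refine (intervalIntegral.norm_integral_le_of_norm_le_const bound).trans ?_
  gcongr
  exact norm_fst_le (p - (u, y))

section ParameterDerivative
variable [ProperSpace E] {F : ℝ × E → G} {F' : ℝ × E → E →L[ℝ] G}

lemma hasFDerivAt_integral_parameter (hab : a ≤ b) (hU : IsOpen U)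
    (hF : ContinuousOn F (Icc a b ×ˢ U)) (hF' : ContinuousOn F' (Icc a b ×ˢ U))
    (hd : ∀ u ∈ Icc a b, ∀ y ∈ U, HasFDerivAt (fun z => F (u, z)) (F' (u, y)) y)
    {u : ℝ} {y : E} (hu : u ∈ Icc a b) (hy : y ∈ U) :
    HasFDerivAt (fun z => ∫ v in a..u, F (v, z)) (∫ v in a..u, F' (v, y)) y := by
  obtain ⟨r, hr, hrU⟩ := Metric.nhds_basis_closedBall.mem_iff.mp (hU.mem_nhds hy)
  have ha : a ∈ Icc a b := ⟨le_rfl, hab⟩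
  obtain ⟨C, hC⟩ := (isCompact_Icc.prod (isCompact_closedBall y r)).exists_bound_of_continuousOn
    (hF'.mono (prod_mono_right hrU))
  have hsub : ∀ t ∈ uIoc a u, t ∈ Icc a b := fun t ht =>
    uIcc_subset_Icc ha hu (uIoc_subset_uIcc ht)
  refine intervalIntegral.hasFDerivAt_integral_of_dominated_of_fderiv_le
    (F := fun z v => F (v, z)) (F' := fun z v => F' (v, z)) (bound := fun _ => C)
    (s := Metric.closedBall y r) (Metric.closedBall_mem_nhds y hr) ?_
    (intervalIntegrable_slice hF hy ha hu) ?_ ?_ intervalIntegrable_const ?_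
  · filter_upwards [hU.mem_nhds hy] with z hz
    exact (intervalIntegrable_slice hF hz ha hu).aestronglyMeasurable_restrict_uIoc
  · exact (intervalIntegrable_slice hF' hy ha hu).aestronglyMeasurable_restrict_uIoc
  · exact Filter.Eventually.of_forall fun t ht z hz => hC (t, z) ⟨hsub t ht, hz⟩
  · exact Filter.Eventually.of_forall fun t ht z hz => hd t (hsub t ht) z (hrU hz)

lemma hasFDerivWithinAt_timePrimitive [CompleteSpace G] (hab : a ≤ b) (hU : IsOpen U)
    (hF : ContinuousOn F (Icc a b ×ˢ U)) (hF' : ContinuousOn F' (Icc a b ×ˢ U))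
    (hd : ∀ u ∈ Icc a b, ∀ y ∈ U, HasFDerivAt (fun z => F (u, z)) (F' (u, y)) y)
    {p : ℝ × E} (hp : p ∈ Icc a b ×ˢ U) :
    HasFDerivWithinAt (timePrimitive a F)
      ((timePrimitive a F' p).comp (ContinuousLinearMap.snd ℝ ℝ E)
        + (ContinuousLinearMap.fst ℝ ℝ E).smulRight (F p)) (Icc a b ×ˢ U) p := by
  obtain ⟨u, y⟩ := p
  have ha : a ∈ Icc a b := ⟨le_rfl, hab⟩
  have frozen : HasFDerivWithinAt (fun p : ℝ × E => ∫ v in a..u, F (v, p.2))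
      ((timePrimitive a F' (u, y)).comp (ContinuousLinearMap.snd ℝ ℝ E)) (Icc a b ×ˢ U) (u, y) :=
    ((hasFDerivAt_integral_parameter hab hU hF hF' hd hp.1 hp.2).comp (u, y)
      (ContinuousLinearMap.snd ℝ ℝ E).hasFDerivAt).hasFDerivWithinAt
  refine (frozen.add (hasFDerivWithinAt_integral_endpoint hF hp.1 hp.2)).congr' (fun q hq => ?_) hp
  exact (intervalIntegral.integral_add_adjacent_intervals
    (intervalIntegrable_slice hF hq.2 ha hp.1)
    (intervalIntegrable_slice hF hq.2 hp.1 hq.1)).symm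

end ParameterDerivative

lemma contDiffOn_timePrimitive_nat {E : Type w} [NormedAddCommGroup E] [NormedSpace ℝ E]
    [ProperSpace E] {U : Set E} (hab : a < b) (hU : IsOpen U) (n : ℕ) :
    ∀ {G : Type w} [NormedAddCommGroup G] [NormedSpace ℝ G] [CompleteSpace G] {F : ℝ × E → G},
      ContDiffOn ℝ n F (Icc a b ×ˢ U) → ContDiffOn ℝ n (timePrimitive a F) (Icc a b ×ˢ U) := by
  have hS : UniqueDiffOn ℝ (Icc a b ×ˢ U) := (uniqueDiffOn_Icc hab).prod hU.uniqueDiffOn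
  induction n with
  | zero =>
    intro G _ _ _ F hF
    rw [Nat.cast_zero, contDiffOn_zero] at hF ⊢
    exact continuousOn_timePrimitive hab.le hF
  | succ n ih =>
    intro G _ _ _ F hF
    rw [Nat.cast_succ] at hF ⊢
    set F' : ℝ × E → E →L[ℝ] G := fun p =>
      (fderivWithin ℝ F (Icc a b ×ˢ U) p).comp (ContinuousLinearMap.inr ℝ ℝ E)
    have hF' : ContDiffOn ℝ n F' (Icc a b ×ˢ U) :=
      (hF.fderivWithin hS le_rfl).clm_comp contDiffOn_const
    have hd : ∀ u ∈ Icc a b, ∀ y ∈ U, HasFDerivAt (fun z => F (u, z)) (F' (u, y)) y := by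
      intro u hu y hy
      have h0 := (hF.differentiableOn (by simp) (u, y) ⟨hu, hy⟩).hasFDerivWithinAt
      exact (h0.comp y ((hasFDerivAt_prodMk_right u y).hasFDerivWithinAt (s := U))
        (fun z hz => (⟨hu, hz⟩ : (u, z) ∈ Icc a b ×ˢ U))).hasFDerivAt (hU.mem_nhds hy)
    have hD := fun p hp => hasFDerivWithinAt_timePrimitive hab.le hU hF.continuousOn
      hF'.continuousOn hd (p := p) hp
    rw [contDiffOn_succ_iff_fderivWithin hS]
    refine ⟨fun p hp => (hD p hp).differentiableWithinAt, by simp, ?_⟩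
    have hFn : ContDiffOn ℝ n F (Icc a b ×ˢ U) := hF.of_le (by simp)
    refine ContDiffOn.congr (f := fun p => (timePrimitive a F' p).comp
        (ContinuousLinearMap.snd ℝ ℝ E) + (ContinuousLinearMap.fst ℝ ℝ E).smulRight (F p))
      ?_ (fun p hp => (hD p hp).fderivWithin (hS p hp))
    exact ((ih hF').clm_comp contDiffOn_const).add (contDiffOn_const.smulRight hFn)

end TimePrimitive

section TimeDependent
variable {u₁ u₂ : ℝ}

lemma SmoothOn.continuousOn_slice {f : ℝ → S2 → ℝ} (hf : SmoothOn u₁ u₂ f) (x : S2) :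
    ContinuousOn (fun u => f u x) (Icc u₁ u₂) :=
  (ContMDiffOn.continuousOn hf).comp (f := fun u => (u, x)) (by fun_prop)
    fun _ hu => ⟨hu, trivial⟩

lemma SmoothOn.partialDeriv {f : ℝ → S2 → ℝ} (h12 : u₁ < u₂) (a : Fin 3)
    (hf : SmoothOn u₁ u₂ f) : SmoothOn u₁ u₂ (fun u => partialDeriv a (f u)) := by
  set S : Set (ℝ × E3) := Icc u₁ u₂ ×ˢ {0}ᶜ
  set f' : ℝ × E3 → (ℝ × E3 →L[ℝ] ℝ) :=
    fderivWithin ℝ (fun p : ℝ × E3 => f p.1 (retraction p.2)) S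
  have hS : UniqueDiffOn ℝ S :=
    (uniqueDiffOn_Icc h12).prod isOpen_compl_singleton.uniqueDiffOn
  refine .of_contDiffOn (H := fun p => f' p (0, EuclideanSpace.single a 1))
    ((hf.contDiffOn.fderivWithin hS (m := ∞) (by simp)).clm_apply contDiffOn_const) ?_
  intro u hu x
  have hx := ne_zero_of_mem_unit_sphere x
  have total := (hf.contDiffOn.differentiableOn (by simp) (u, (x : E3)) ⟨hu, hx⟩).hasFDerivWithinAt
  have slice : HasFDerivAt (f u ∘ retraction)
      ((f' (u, x)).comp (ContinuousLinearMap.inr ℝ ℝ E3)) (x : E3) :=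
    (total.comp (x : E3) ((hasFDerivAt_prodMk_right u (x : E3)).hasFDerivWithinAt (s := {0}ᶜ))
      (fun y hy => ⟨hu, hy⟩)).hasFDerivAt (isOpen_compl_singleton.mem_nhds hx)
  rw [partialDeriv_eq_fderiv, slice.fderiv]
  rfl

lemma SmoothOn.timeIntegral {f : ℝ → S2 → ℝ} (h12 : u₁ < u₂) (hf : SmoothOn u₁ u₂ f) :
    SmoothOn u₁ u₂ (fun u x => ∫ v in u₁..u, f v x) := by
  refine .of_contDiffOn (contDiffOn_infty.mpr fun n => contDiffOn_timePrimitive_nat h12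
    isOpen_compl_singleton n (contDiffOn_infty.mp hf.contDiffOn n)) fun u _ x => ?_
  simp only [timePrimitive, retraction_coe]

lemma hasDerivWithinAt_integral_Icc {F : Type*} [NormedAddCommGroup F] [NormedSpace ℝ F]
    [CompleteSpace F] {g : ℝ → F} {a b u : ℝ} (hg : ContinuousOn g (Icc a b))
    (hu : u ∈ Icc a b) :
    HasDerivWithinAt (fun v => ∫ s in a..v, g s) (g u) (Icc a b) u := by
  have : Fact (u ∈ Icc a b) := ⟨hu⟩
  exact intervalIntegral.integral_hasDerivWithinAt_right
    (hg.mono (uIcc_subset_Icc ⟨le_rfl, hu.1.trans hu.2⟩ hu)).intervalIntegrable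
    (hg.stronglyMeasurableAtFilter_nhdsWithin measurableSet_Icc u) (hg u hu)

lemma eqOn_Icc_of_hasDerivWithinAt {F : Type*} [NormedAddCommGroup F] [NormedSpace ℝ F]
    {f g f' : ℝ → F} {a b : ℝ} (hf : ∀ u ∈ Icc a b, HasDerivWithinAt f (f' u) (Icc a b) u)
    (hg : ∀ u ∈ Icc a b, HasDerivWithinAt g (f' u) (Icc a b) u) (h : f a = g a) :
    EqOn f g (Icc a b) := by
  refine eq_of_has_deriv_right_eq (f' := f') (fun u hu => ?_) (fun u hu => ?_)
    (fun u hu => (hf u hu).continuousWithinAt) (fun u hu => (hg u hu).continuousWithinAt) h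
  · exact (hf u (Ico_subset_Icc_self hu)).mono_of_mem_nhdsWithin (Icc_mem_nhdsGE_of_mem hu)
  · exact (hg u (Ico_subset_Icc_self hu)).mono_of_mem_nhdsWithin (Icc_mem_nhdsGE_of_mem hu)

end TimeDependent

/-! ### Integration over the sphere -/

section Integral
variable {f g : S2 → ℝ}

lemma Smooth.integrable (hf : Smooth f) : Integrable f (volume : Measure E3).toSphere :=
  hf.continuous.integrable_of_hasCompactSupport (HasCompactSupport.of_compactSpace f)

lemma sphereIntegral_add (hf : Smooth f) (hg : Smooth g) :
    sphereIntegral (fun x => f x + g x) = sphereIntegral f + sphereIntegral g :=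
  integral_add hf.integrable hg.integrable

lemma sphereIntegral_sub (hf : Smooth f) (hg : Smooth g) :
    sphereIntegral (fun x => f x - g x) = sphereIntegral f - sphereIntegral g :=
  integral_sub hf.integrable hg.integrable

lemma sphereIntegral_const_mul (c : ℝ) (f : S2 → ℝ) :
    sphereIntegral (fun x => c * f x) = c * sphereIntegral f :=
  integral_const_mul c f

lemma sphereIntegral_sum {ι : Type*} {s : Finset ι} {f : ι → S2 → ℝ}
    (hf : ∀ i ∈ s, Smooth (f i)) :
    sphereIntegral (fun x => ∑ i ∈ s, f i x) = ∑ i ∈ s, sphereIntegral (f i) :=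
  integral_finsetSum _ fun i hi => (hf i hi).integrable

lemma integral_rotation_eq_zero {ι : Type*} [Fintype ι] [DecidableEq ι]
    {G : EuclideanSpace ℝ ι → ℝ} (hG : ContDiff ℝ 1 G) (hc : HasCompactSupport G) (a b : ι) :
    ∫ y, (y a * fderiv ℝ G y (EuclideanSpace.single b 1)
      - y b * fderiv ℝ G y (EuclideanSpace.single a 1)) = 0 := by
  have continuous_deriv (b : ι) : Continuous fun y => fderiv ℝ G y (EuclideanSpace.single b 1) :=
    (hG.continuous_fderiv (by simp)).clm_apply continuous_const
  have integrable (a b : ι) :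
      Integrable fun y => y a * fderiv ℝ G y (EuclideanSpace.single b 1) :=
    Continuous.integrable_of_hasCompactSupport
      ((by fun_prop : Continuous fun y : EuclideanSpace ℝ ι => y a).mul (continuous_deriv b))
      (hc.fderiv_apply ℝ _).mul_left
  have hproj (a : ι) (y : EuclideanSpace ℝ ι) :
      fderiv ℝ (fun y : EuclideanSpace ℝ ι => y a) y = EuclideanSpace.proj a :=
    (EuclideanSpace.proj a : EuclideanSpace ℝ ι →L[ℝ] ℝ).hasFDerivAt.fderiv
  have by_parts (a b : ι) : ∫ y, y a * fderiv ℝ G y (EuclideanSpace.single b 1)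
      = - ((if a = b then 1 else 0) * ∫ y, G y) := by
    rw [integral_mul_fderiv_eq_neg_fderiv_mul_of_integrable ?_ (integrable a b) ?_
      (fun y _ => by fun_prop) (fun y _ => hG.differentiable (by simp) y)]
    · split_ifs with h <;> simp [hproj, h]
    · by_cases h : a = b <;> simp [hproj, h, hG.continuous.integrable_of_hasCompactSupport hc]
    · exact Continuous.integrable_of_hasCompactSupport (by fun_prop) hc.mul_left
  rw [integral_sub (integrable a b) (integrable b a), by_parts, by_parts]
  simp only [eq_comm, sub_self]

/-- A bump function supported in `(0, ∞)`, used to localise integrals over `ℝ³` to an annulus. -/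
def radialBump : ContDiffBump (2 : ℝ) := ⟨1 / 2, 1, by norm_num, by norm_num⟩

/-- A radial cut-off function on `ℝ³` with compact support away from the origin. The square of the
norm makes its smoothness at the origin immediate. -/
def cutoff (y : E3) : ℝ := radialBump (‖y‖ ^ 2)

lemma contDiff_cutoff : ContDiff ℝ ∞ cutoff :=
  radialBump.contDiff.comp (contDiff_norm_sq ℝ)

lemma tsupport_cutoff_subset : tsupport cutoff ⊆ {y : E3 | 1 ≤ ‖y‖ ^ 2 ∧ ‖y‖ ^ 2 ≤ 3} := by
  refine closure_minimal (fun y hy => ?_) ?_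
  · have : ‖y‖ ^ 2 ∈ Function.support radialBump := hy
    rw [radialBump.support_eq, Metric.mem_ball, Real.dist_eq, abs_lt] at this
    simp only [radialBump] at this
    constructor <;> linarith [this.1, this.2]
  · have h : Continuous fun y : E3 => ‖y‖ ^ 2 := by fun_prop
    exact (isClosed_le continuous_const h).inter (isClosed_le h continuous_const)

lemma ne_zero_of_mem_tsupport_cutoff {y : E3} (hy : y ∈ tsupport cutoff) : y ≠ 0 := by
  rintro rfl
  simpa using (tsupport_cutoff_subset hy).1.trans_lt' one_pos

lemma hasCompactSupport_cutoff : HasCompactSupport cutoff := by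
  refine HasCompactSupport.of_support_subset_isCompact (isCompact_closedBall (0 : E3) 2) ?_
  intro y hy
  have := (tsupport_cutoff_subset (subset_tsupport _ hy)).2
  rw [mem_closedBall_zero_iff]
  nlinarith [norm_nonneg y]

lemma coord_mul_fderiv_cutoff_comm (y : E3) (a b : Fin 3) :
    y a * fderiv ℝ cutoff y (EuclideanSpace.single b 1)
      = y b * fderiv ℝ cutoff y (EuclideanSpace.single a 1) := by
  have hd : HasDerivAt radialBump (deriv radialBump (‖y‖ ^ 2)) (‖y‖ ^ 2) :=
    ((radialBump.contDiff (n := 1)).differentiable (by simp) _).hasDerivAt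
  have chain : fderiv ℝ cutoff y = _ :=
    (hd.comp_hasFDerivAt y (hasStrictFDerivAt_norm_sq y).hasFDerivAt).fderiv
  simp [chain, EuclideanSpace.inner_single_right]
  ring

lemma integral_radial_mul_comp_retraction (φ : ℝ → ℝ) (k : S2 → ℝ) :
    ∫ y : E3, φ ‖y‖ * k (retraction y)
      = sphereIntegral k * ∫ r : Ioi (0 : ℝ), φ r ∂(Measure.volumeIoiPow 2) := by
  have hd : Module.finrank ℝ E3 - 1 = 2 := by simp
  calc ∫ y : E3, φ ‖y‖ * k (retraction y)
      = ∫ y : ({0}ᶜ : Set E3), φ ‖(y : E3)‖ * k (retraction y)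
          ∂((volume : Measure E3).comap (fun y : ({0}ᶜ : Set E3) => (y : E3))) := by
        rw [integral_subtype_comap (measurableSet_singleton _).compl
          fun y : E3 => φ ‖y‖ * k (retraction y), restrict_compl_singleton]
    _ = ∫ p, k p.1 * φ p.2
          ∂((volume : Measure E3).toSphere.prod (.volumeIoiPow (Module.finrank ℝ E3 - 1))) := by
        rw [← (volume : Measure E3).measurePreserving_homeomorphUnitSphereProd.integral_comp
          (Homeomorph.measurableEmbedding _)]
        refine integral_congr_ae (Filter.Eventually.of_forall fun y => ?_)
        simp only [homeomorphUnitSphereProd_apply_snd_coe]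
        rw [mul_comm]
        congr 2
        exact Subtype.ext (by simp [coe_retraction y.2])
    _ = sphereIntegral k * ∫ r : Ioi (0 : ℝ), φ r ∂(Measure.volumeIoiPow 2) := by
        rw [hd, integral_prod_mul (fun x => k x) fun r : Ioi (0 : ℝ) => φ r]
        rfl

lemma sphereIntegral_eq_zero_of_integral_cutoff_mul {k : S2 → ℝ}
    (h : ∫ y, cutoff y * k (retraction y) = 0) : sphereIntegral k = 0 := by
  have polar := integral_radial_mul_comp_retraction (fun r => radialBump (r ^ 2))
  have pos : 0 < ∫ y, cutoff y := by
    refine contDiff_cutoff.continuous.integral_pos_of_hasCompactSupport_nonneg_nonzero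
      hasCompactSupport_cutoff (fun y => radialBump.nonneg) (x := √2 • EuclideanSpace.single 0 1) ?_
    have : ‖√2 • EuclideanSpace.single (0 : Fin 3) (1 : ℝ)‖ ^ 2 = 2 := by
      rw [norm_smul, mul_pow]; simp
    rw [cutoff, this]
    exact (radialBump.pos_of_mem_ball (by simp [radialBump])).ne'
  have factor_ne_zero : ∫ r : Ioi (0 : ℝ), radialBump ((r : ℝ) ^ 2) ∂(Measure.volumeIoiPow 2) ≠ 0 :=
    fun h0 => pos.ne' <| by simpa [h0, cutoff] using polar fun _ => 1
  exact (mul_eq_zero.mp ((polar k).symm.trans h)).resolve_right factor_ne_zero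

/-- The rotation field `y_a ∂_b - y_b ∂_a` kills radial functions, so the identity on the sphere
follows from the one on `ℝ³` for the product of a radial cut-off and `f ∘ retraction`. -/
lemma sphereIntegral_rotation (hf : Smooth f) (a b : Fin 3) :
    sphereIntegral (fun x => coord a x * partialDeriv b f x - coord b x * partialDeriv a f x)
      = 0 := by
  set G : E3 → ℝ := fun y => cutoff y * (f ∘ retraction) y
  have hG : ContDiff ℝ 1 G := contDiff_iff_contDiffAt.mpr fun y => by
    by_cases hy : y ∈ tsupport cutoff
    · exact (contDiff_cutoff.contDiffAt.mul
        (hf.contDiffAt (ne_zero_of_mem_tsupport_cutoff hy))).of_le (by simp)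
    · refine contDiffAt_const (c := (0 : ℝ)) |>.congr_of_eventuallyEq ?_
      filter_upwards [notMem_tsupport_iff_eventuallyEq.mp hy] with z hz
      simp [G, hz]
  refine sphereIntegral_eq_zero_of_integral_cutoff_mul
    (.trans (integral_congr_ae ?_) (integral_rotation_eq_zero hG hasCompactSupport_cutoff.mul_right
      a b))
  filter_upwards [compl_mem_ae_iff.mpr (measure_singleton (0 : E3))] with y hy
  have hy : y ≠ 0 := hy
  have leibniz (b : Fin 3) : fderiv ℝ G y (EuclideanSpace.single b 1)
      = cutoff y * fderiv ℝ (f ∘ retraction) y (EuclideanSpace.single b 1)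
        + f (retraction y) * fderiv ℝ cutoff y (EuclideanSpace.single b 1) :=
    DFunLike.congr_fun (fderiv_mul (contDiff_cutoff.differentiable (by simp) y)
      ((hf.contDiffAt hy).differentiableAt (by simp))) _
  have coord_mul_partialDeriv (a b : Fin 3) :
      coord a (retraction y) * partialDeriv b f (retraction y)
        = y a * fderiv ℝ (f ∘ retraction) y (EuclideanSpace.single b 1) := by
    rw [partialDeriv_retraction b hf hy, coord, coe_retraction hy]
    simp only [PiLp.smul_apply, smul_eq_mul]
    field_simp
  simp only [leibniz, coord_mul_partialDeriv]
  linear_combination -f (retraction y) * coord_mul_fderiv_cutoff_comm y a b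

/-- The `∂_b` are not tangential fields: the constant vector field has normal component `X^b`, and
the mean curvature of the sphere is `2`. -/
lemma sphereIntegral_partialDeriv (hf : Smooth f) (b : Fin 3) :
    sphereIntegral (partialDeriv b f) = 2 * sphereIntegral (fun x => coord b x * f x) := by
  have hx := smooth_coord
  have rotations : partialDeriv b f = fun x =>
      (∑ a, (coord a x * partialDeriv b (fun y => coord a y * f y) x
        - coord b x * partialDeriv a (fun y => coord a y * f y) x)) + 2 * (coord b x * f x) := by
    funext x
    have leibniz (a : Fin 3) : coord a x * partialDeriv b (fun y => coord a y * f y) x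
        - coord b x * partialDeriv a (fun y => coord a y * f y) x
        = coord a x * coord a x * partialDeriv b f x - coord b x * (coord a x * partialDeriv a f x)
          + (coord a x * (if b = a then 1 else 0) - coord b x) * f x := by
      rw [partialDeriv_mul _ (hx a) hf, partialDeriv_mul _ (hx a) hf, partialDeriv_coord,
        partialDeriv_coord, metric, metric, if_pos rfl, coord, coord]
      ring
    rw [Finset.sum_congr rfl fun a _ => leibniz a]
    simp only [Finset.sum_add_distrib, Finset.sum_sub_distrib, ← Finset.mul_sum,
      ← Finset.sum_mul, coord, sum_coord_sq, sum_coord_mul_partialDeriv hf]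
    simp
    ring
  have smooth_rotation (a : Fin 3) :=
    ((hx a).mul (smooth_partialDeriv b ((hx a).mul hf))).sub
      ((hx b).mul (smooth_partialDeriv a ((hx a).mul hf)))
  rw [rotations, sphereIntegral_add (.sum fun a _ => smooth_rotation a)
    (((hx b).mul hf).const_mul 2), sphereIntegral_sum fun a _ => smooth_rotation a,
    sphereIntegral_const_mul]
  simp [sphereIntegral_rotation ((hx _).mul hf)]

end Integral

section TimeIntegral
variable {u₁ u₂ u : ℝ} {f f' g g' : ℝ → S2 → ℝ}

lemma intervalIntegral_sphereIntegral (hf : SmoothOn u₁ u₂ f) (hu : u ∈ Icc u₁ u₂) :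
    ∫ v in u₁..u, sphereIntegral (f v) = sphereIntegral (fun x => ∫ v in u₁..u, f v x) := by
  refine intervalIntegral_integral_swap ?_
  have : IntegrableOn (fun p : ℝ × S2 => f p.1 p.2) (Icc u₁ u₂ ×ˢ univ)
      (volume.prod (volume : Measure E3).toSphere) :=
    (ContMDiffOn.continuousOn hf).integrableOn_compact (isCompact_Icc.prod isCompact_univ)
  rw [IntegrableOn, ← Measure.prod_restrict, Measure.restrict_univ] at this
  refine this.mono_measure (Measure.prod_mono (Measure.restrict_mono ?_ le_rfl) le_rfl)
  exact uIoc_subset_uIcc.trans (uIcc_subset_Icc ⟨le_rfl, hu.1.trans hu.2⟩ hu)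

lemma sphereIntegral_eq_add_flux (hf : SmoothOn u₁ u₂ f) (hf' : SmoothOn u₁ u₂ f')
    (hd : ∀ u ∈ Icc u₁ u₂, ∀ x, HasDerivWithinAt (fun v => f v x) (f' u x) (Icc u₁ u₂) u)
    (hu : u ∈ Icc u₁ u₂) :
    sphereIntegral (f u) = sphereIntegral (f u₁) + ∫ v in u₁..u, sphereIntegral (f' v) := by
  have hu₁ : u₁ ∈ Icc u₁ u₂ := ⟨le_rfl, hu.1.trans hu.2⟩
  have increment (x : S2) : ∫ v in u₁..u, f' v x = f u x - f u₁ x :=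
    eqOn_Icc_of_hasDerivWithinAt
      (fun v hv => hasDerivWithinAt_integral_Icc (hf'.continuousOn_slice x) hv)
      (fun v hv => (hd v hv x).sub_const (f u₁ x)) (by simp) hu
  rw [intervalIntegral_sphereIntegral hf' hu]
  simp only [increment]
  rw [sphereIntegral_sub (hf.smooth hu) (hf.smooth hu₁), add_sub_cancel]

lemma sphereIntegral_eq_of_flux_eq (hf : SmoothOn u₁ u₂ f) (hf' : SmoothOn u₁ u₂ f')
    (hg : SmoothOn u₁ u₂ g) (hg' : SmoothOn u₁ u₂ g')
    (hfd : ∀ u ∈ Icc u₁ u₂, ∀ x, HasDerivWithinAt (fun v => f v x) (f' u x) (Icc u₁ u₂) u)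
    (hgd : ∀ u ∈ Icc u₁ u₂, ∀ x, HasDerivWithinAt (fun v => g v x) (g' u x) (Icc u₁ u₂) u)
    (init : sphereIntegral (f u₁) = sphereIntegral (g u₁))
    (flux : ∀ u ∈ Icc u₁ u₂, sphereIntegral (f' u) = sphereIntegral (g' u))
    (hu : u ∈ Icc u₁ u₂) : sphereIntegral (f u) = sphereIntegral (g u) := by
  rw [sphereIntegral_eq_add_flux hf hf' hfd hu, sphereIntegral_eq_add_flux hg hg' hgd hu, init]
  congr 1
  exact intervalIntegral.integral_congr fun v hv =>
    flux v (uIcc_subset_Icc ⟨le_rfl, hu.1.trans hu.2⟩ hu hv)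

end TimeIntegral

/-! ### Tensor calculus in Cartesian components -/

section Metric
variable (x : S2)

lemma metric_symm (i j : Fin 3) : metric x i j = metric x j i := by
  simp only [metric, eq_comm (a := i)]; ring

lemma smooth_metric (i j : Fin 3) : Smooth (fun x => metric x i j) :=
  (smooth_const _).sub ((smooth_coord i).mul (smooth_coord j))

lemma sum_metric_mul (v : Fin 3 → ℝ) (i : Fin 3) :
    ∑ a, metric x i a * v a = v i - (x : E3) i * ∑ a, (x : E3) a * v a := by
  simp [metric, sub_mul, Finset.mul_sum, mul_assoc]

lemma sum_metric_mul_of_tangent {v : Fin 3 → ℝ} (hv : ∑ i, (x : E3) i * v i = 0) (i : Fin 3) :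
    ∑ a, metric x i a * v a = v i := by
  rw [sum_metric_mul, hv, mul_zero, sub_zero]

lemma sum_mul_sum_metric_mul_of_tangent {v : Fin 3 → ℝ} (hv : ∑ i, (x : E3) i * v i = 0)
    (w : Fin 3 → ℝ) : ∑ i, v i * ∑ a, metric x i a * w a = ∑ i, v i * w i := by
  simp_rw [sum_metric_mul, mul_sub, Finset.sum_sub_distrib, ← mul_assoc, ← Finset.sum_mul,
    mul_comm (v _) _, hv, zero_mul, sub_zero]

lemma sum_coord_mul_metric (j : Fin 3) : ∑ i, (x : E3) i * metric x i j = 0 := by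
  simp_rw [metric_symm x _ j, mul_comm, sum_metric_mul, sum_coord_sq, mul_one, sub_self]

lemma sum_coord_mul_sum_metric_mul (v : Fin 3 → ℝ) :
    ∑ i, (x : E3) i * ∑ a, metric x i a * v a = 0 := by
  simp_rw [Finset.mul_sum, ← mul_assoc]
  rw [Finset.sum_comm]
  simp [← Finset.sum_mul, sum_coord_mul_metric]

end Metric

section OneForms
variable {v w : S2 → Fin 3 → ℝ}

lemma IsOneForm.add (hv : IsOneForm v) (hw : IsOneForm w) :
    IsOneForm (fun x i => v x i + w x i) := fun x => by
  simp only [mul_add, Finset.sum_add_distrib, hv x, hw x, add_zero]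

lemma IsOneForm.sub (hv : IsOneForm v) (hw : IsOneForm w) :
    IsOneForm (fun x i => v x i - w x i) := fun x => by
  simp only [mul_sub, Finset.sum_sub_distrib, hv x, hw x, sub_zero]

lemma IsOneForm.mul_left (f : S2 → ℝ) (hw : IsOneForm w) :
    IsOneForm (fun x i => f x * w x i) := fun x => by
  simp only [mul_left_comm _ (f x), ← Finset.mul_sum, hw x, mul_zero]

lemma IsOneForm.const_mul (c : ℝ) (hw : IsOneForm w) : IsOneForm (fun x i => c * w x i) :=
  hw.mul_left fun _ => c

lemma IsOneForm.timeIntegral {u₁ u₂ u : ℝ} {w : ℝ → S2 → Fin 3 → ℝ} (hw : SmoothOn u₁ u₂ w)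
    (ht : ∀ u ∈ Icc u₁ u₂, IsOneForm (w u)) (hu : u ∈ Icc u₁ u₂) :
    IsOneForm (fun x i => ∫ v in u₁..u, w v x i) := fun x => by
  have subset : uIcc u₁ u ⊆ Icc u₁ u₂ := uIcc_subset_Icc ⟨le_rfl, hu.1.trans hu.2⟩ hu
  have integrable (i : Fin 3) :
      IntervalIntegrable (fun v => (x : E3) i * w v x i) volume u₁ u :=
    ((((smoothOn_pi.mp hw i).continuousOn_slice x).mono subset).intervalIntegrable).const_mul _
  calc ∑ i, (x : E3) i * ∫ v in u₁..u, w v x i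
      = ∫ v in u₁..u, ∑ i, (x : E3) i * w v x i := by
        rw [intervalIntegral.integral_finsetSum fun i _ => integrable i]
        simp only [intervalIntegral.integral_const_mul]
    _ = 0 := intervalIntegral.integral_zero_ae (.of_forall fun v hv =>
        ht v (subset (uIoc_subset_uIcc hv)) x)

end OneForms

section Derivatives
variable {f : S2 → ℝ} {w : S2 → Fin 3 → ℝ} {T : S2 → Fin 3 → Fin 3 → ℝ}

lemma grad_eq (hf : Smooth f) (x : S2) (i : Fin 3) : grad f x i = partialDeriv i f x :=
  sum_metric_mul_of_tangent x (sum_coord_mul_partialDeriv hf x) i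

lemma grad_coord (k : Fin 3) (x : S2) (i : Fin 3) : grad (coord k) x i = metric x i k := by
  rw [grad_eq (smooth_coord k), partialDeriv_coord]

lemma isOneForm_grad (f : S2 → ℝ) : IsOneForm (grad f) := fun x =>
  sum_coord_mul_sum_metric_mul x _

lemma isOneForm_covD1_left (w : S2 → Fin 3 → ℝ) (j : Fin 3) :
    IsOneForm (fun x i => covD1 w x i j) := fun x => by
  simp_rw [covD1, mul_assoc, ← Finset.mul_sum]
  exact sum_coord_mul_sum_metric_mul x _

lemma isOneForm_covD1_right (w : S2 → Fin 3 → ℝ) (i : Fin 3) :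
    IsOneForm (fun x => covD1 w x i) := fun x => by
  have factor (j : Fin 3) : covD1 w x i j
      = ∑ b, metric x j b * ∑ a, metric x i a * partialDeriv a (fun y => w y b) x := by
    rw [covD1, Finset.sum_comm]
    simp only [Finset.mul_sum, mul_assoc, mul_left_comm]
  simp_rw [factor]
  exact sum_coord_mul_sum_metric_mul x _

lemma covD1_eq_sum_metric_mul (hw : Smooth w) (x : S2) (i j : Fin 3) :
    covD1 w x i j = ∑ b, metric x j b * partialDeriv i (fun y => w y b) x := by
  have tangential (b : Fin 3) :=
    sum_metric_mul_of_tangent x (sum_coord_mul_partialDeriv (smooth_pi.mp hw b) x) i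
  simp_rw [← tangential, covD1, Finset.mul_sum]
  rw [Finset.sum_comm]
  exact Finset.sum_congr rfl fun b _ => Finset.sum_congr rfl fun a _ => by ring

lemma IsOneForm.sum_coord_mul_partialDeriv (ht : IsOneForm w) (hw : Smooth w) (a : Fin 3)
    (x : S2) : ∑ b, (x : E3) b * partialDeriv a (fun y => w y b) x = - w x a := by
  have hw := smooth_pi.mp hw
  have leibniz : partialDeriv a (fun y => ∑ b, coord b y * w y b) x
      = w x a + ∑ b, (x : E3) b * partialDeriv a (fun y => w y b) x := by
    rw [partialDeriv_sum _ a fun b _ => (smooth_coord b).mul (hw b)]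
    simp_rw [partialDeriv_mul a (smooth_coord _) (hw _), partialDeriv_coord,
      Finset.sum_add_distrib, sum_metric_mul_of_tangent x (ht x) a, coord]
  rw [show (fun y => ∑ b, coord b y * w y b) = fun _ => 0 from funext ht,
    partialDeriv_const] at leibniz
  linarith

lemma IsOneForm.covD1_eq (ht : IsOneForm w) (hw : Smooth w) (x : S2) (i j : Fin 3) :
    covD1 w x i j = partialDeriv i (fun y => w y j) x + (x : E3) j * w x i := by
  rw [covD1_eq_sum_metric_mul hw, sum_metric_mul, ht.sum_coord_mul_partialDeriv hw]
  ring

lemma div1_eq (hw : Smooth w) (x : S2) :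
    div1 w x = ∑ i, partialDeriv i (fun y => w y i) x := by
  simp only [div1, covD1_eq_sum_metric_mul hw]
  rw [Finset.sum_comm]
  refine Finset.sum_congr rfl fun b _ => ?_
  simp_rw [metric_symm x _ b]
  exact sum_metric_mul_of_tangent x (sum_coord_mul_partialDeriv (smooth_pi.mp hw b) x) b

lemma div1_mul (hf : Smooth f) (hw : Smooth w) (x : S2) :
    div1 (fun y i => f y * w y i) x = ∑ i, grad f x i * w x i + f x * div1 w x := by
  have hw' := smooth_pi.mp hw
  rw [div1_eq (smooth_pi.mpr fun i => hf.mul (hw' i)), div1_eq hw]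
  simp only [partialDeriv_mul _ hf (hw' _), Finset.sum_add_distrib, Finset.mul_sum, grad_eq hf]

lemma div2_eq_sum_metric_mul_div1 (T : S2 → Fin 3 → Fin 3 → ℝ) (x : S2) (j : Fin 3) :
    div2 T x j = ∑ c, metric x j c * div1 (fun y b => T y b c) x := by
  simp only [div2, covD2, div1, covD1, Fin.sum_univ_three]
  ring

lemma isOneForm_div2 (T : S2 → Fin 3 → Fin 3 → ℝ) : IsOneForm (div2 T) := fun x => by
  simp_rw [div2_eq_sum_metric_mul_div1]
  exact sum_coord_mul_sum_metric_mul x _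

lemma div2_eq_div1 (hT : Smooth T) (ht : ∀ i, IsOneForm (fun x => T x i)) {x : S2}
    (htr : ∑ i, T x i i = 0) (j : Fin 3) : div2 T x j = div1 (fun y i => T y i j) x := by
  have hT := smooth_pi₂.mp hT
  have hcol (c : Fin 3) : Smooth (fun y i => T y i c) := smooth_pi.mpr fun i => hT i c
  rw [div2_eq_sum_metric_mul_div1, sum_metric_mul_of_tangent]
  calc ∑ c, (x : E3) c * div1 (fun y i => T y i c) x
      = ∑ i, ∑ c, (x : E3) c * partialDeriv i (fun y => T y i c) x := by
        rw [Finset.sum_comm]; simp only [div1_eq (hcol _), Finset.mul_sum]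
    _ = 0 := by
        simp only [(ht _).sum_coord_mul_partialDeriv (smooth_pi.mpr (hT _)),
          Finset.sum_neg_distrib, htr, neg_zero]

end Derivatives

section SmoothFamilies
variable {u₁ u₂ : ℝ} (h12 : u₁ < u₂)
include h12

lemma smoothOn_grad {f : ℝ → S2 → ℝ} (hf : SmoothOn u₁ u₂ f) :
    SmoothOn u₁ u₂ (fun u => grad (f u)) :=
  smoothOn_pi.mpr fun i => .sum fun a _ =>
    ((smooth_metric i a).smoothOn u₁ u₂).mul (hf.partialDeriv h12 a)

lemma smoothOn_covD1 {w : ℝ → S2 → Fin 3 → ℝ} (hw : SmoothOn u₁ u₂ w) :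
    SmoothOn u₁ u₂ (fun u => covD1 (w u)) :=
  smoothOn_pi₂.mpr fun i j => .sum fun a _ => .sum fun b _ =>
    (((smooth_metric i a).mul (smooth_metric j b)).smoothOn u₁ u₂).mul
      ((smoothOn_pi.mp hw b).partialDeriv h12 a)

lemma smoothOn_div1 {w : ℝ → S2 → Fin 3 → ℝ} (hw : SmoothOn u₁ u₂ w) :
    SmoothOn u₁ u₂ (fun u => div1 (w u)) :=
  .sum fun i _ => smoothOn_pi₂.mp (smoothOn_covD1 h12 hw) i i

lemma smoothOn_div2 {T : ℝ → S2 → Fin 3 → Fin 3 → ℝ} (hT : SmoothOn u₁ u₂ T) :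
    SmoothOn u₁ u₂ (fun u => div2 (T u)) := by
  simp only [smoothOn_pi, div2_eq_sum_metric_mul_div1]
  exact fun j => .sum fun c _ => ((smooth_metric j c).smoothOn u₁ u₂).mul
    (smoothOn_div1 h12 (smoothOn_pi.mpr fun b => smoothOn_pi₂.mp hT b c))

end SmoothFamilies

lemma SmoothOn.inner2 {u₁ u₂ : ℝ} {S T : ℝ → S2 → Fin 3 → Fin 3 → ℝ} (hS : SmoothOn u₁ u₂ S)
    (hT : SmoothOn u₁ u₂ T) : SmoothOn u₁ u₂ (fun u => inner2 (S u) (T u)) :=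
  .sum fun i _ => .sum fun j _ => (smoothOn_pi₂.mp hS i j).mul (smoothOn_pi₂.mp hT i j)

section Smooth
variable {f : S2 → ℝ} {w : S2 → Fin 3 → ℝ} {S T : S2 → Fin 3 → Fin 3 → ℝ}

lemma smooth_grad (hf : Smooth f) : Smooth (grad f) :=
  .of_smoothOn (smoothOn_grad one_pos (hf.smoothOn 0 1))

lemma smooth_covD1 (hw : Smooth w) : Smooth (covD1 w) :=
  .of_smoothOn (smoothOn_covD1 one_pos (hw.smoothOn 0 1))

lemma smooth_div1 (hw : Smooth w) : Smooth (div1 w) :=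
  .of_smoothOn (smoothOn_div1 one_pos (hw.smoothOn 0 1))

lemma smooth_div2 (hT : Smooth T) : Smooth (div2 T) :=
  .of_smoothOn (smoothOn_div2 one_pos (hT.smoothOn 0 1))

lemma smooth_inner2 (hS : Smooth S) (hT : Smooth T) : Smooth (inner2 S T) :=
  .of_smoothOn ((hS.smoothOn 0 1).inner2 (hT.smoothOn 0 1))

end Smooth

section Curl
variable {w : S2 → Fin 3 → ℝ}

/-- The exterior derivative `∇_i w_j - ∇_j w_i` of a one-form, as it enters the evolution equation
of the angular momentum aspect. -/
def curl (w : S2 → Fin 3 → ℝ) (x : S2) (i j : Fin 3) : ℝ := covD1 w x i j - covD1 w x j i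

lemma curl_antisymm (w : S2 → Fin 3 → ℝ) (x : S2) (i j : Fin 3) :
    curl w x i j = - curl w x j i := by
  simp only [curl, neg_sub]

lemma smooth_curl (hw : Smooth w) : Smooth (curl w) :=
  smooth_pi₂.mpr fun i j =>
    (smooth_pi₂.mp (smooth_covD1 hw) i j).sub (smooth_pi₂.mp (smooth_covD1 hw) j i)

lemma smoothOn_curl {u₁ u₂ : ℝ} (h12 : u₁ < u₂) {w : ℝ → S2 → Fin 3 → ℝ}
    (hw : SmoothOn u₁ u₂ w) : SmoothOn u₁ u₂ (fun u => curl (w u)) :=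
  smoothOn_pi₂.mpr fun i j => (smoothOn_pi₂.mp (smoothOn_covD1 h12 hw) i j).sub
    (smoothOn_pi₂.mp (smoothOn_covD1 h12 hw) j i)

lemma isOneForm_curl_right (w : S2 → Fin 3 → ℝ) (i : Fin 3) :
    IsOneForm (fun x => curl w x i) := fun x => by
  simp only [curl, mul_sub, Finset.sum_sub_distrib]
  rw [isOneForm_covD1_right w i x, isOneForm_covD1_left w i x, sub_zero]

lemma isOneForm_curl_left (w : S2 → Fin 3 → ℝ) (j : Fin 3) :
    IsOneForm (fun x i => curl w x i j) := fun x => by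
  simp_rw [curl_antisymm w x _ j, mul_neg, Finset.sum_neg_distrib, isOneForm_curl_right w j x,
    neg_zero]

lemma trace_curl (w : S2 → Fin 3 → ℝ) (x : S2) : ∑ i, curl w x i i = 0 := by
  simp [curl]

end Curl

/-! ### The area form and the duality map -/

section AreaForm
variable (x : S2)

lemma sum_sum_mul_eq_zero_of_antisymm_of_symm {ι : Type*} [Fintype ι] {A B : ι → ι → ℝ}
    (hA : ∀ i j, A i j = -A j i) (hB : ∀ i j, B i j = B j i) :
    ∑ i, ∑ j, A i j * B i j = 0 := by
  have swap : ∑ i, ∑ j, A i j * B i j = - ∑ i, ∑ j, A i j * B i j := by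
    conv_lhs => rw [Finset.sum_comm]
    simp_rw [← Finset.sum_neg_distrib, ← neg_mul]
    exact Finset.sum_congr rfl fun j _ => Finset.sum_congr rfl fun i _ => by rw [hA i j, hB i j]
  linarith

/-- The Levi-Civita symbol of `ℝ³` as the Vandermonde product of the indices `0, 1, 2`, half of
which is the sign of the permutation. -/
def leviCivita (i j k : Fin 3) : ℝ :=
  ((j : ℕ) - (i : ℕ)) * ((k : ℕ) - (i : ℕ)) * ((k : ℕ) - (j : ℕ)) / 2

lemma leviCivita_swap_right (i j k : Fin 3) : leviCivita i j k = - leviCivita i k j := by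
  simp only [leviCivita]; ring

lemma areaForm_eq (i j : Fin 3) : areaForm x i j = ∑ k, leviCivita i j k * (x : E3) k := by
  simp only [areaForm, Matrix.det_fin_three, leviCivita, Fin.sum_univ_three]
  fin_cases i <;> fin_cases j <;> simp <;> norm_num

lemma areaForm_antisymm (i j : Fin 3) : areaForm x i j = - areaForm x j i := by
  simp only [areaForm_eq, leviCivita, Fin.sum_univ_three]; ring

lemma smooth_areaForm (i j : Fin 3) : Smooth (fun x => areaForm x i j) := by
  simp only [areaForm_eq]
  exact .sum fun k _ => (smooth_coord k).const_mul _

lemma partialDeriv_areaForm (a i j : Fin 3) :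
    partialDeriv a (fun y => areaForm y i j) x = ∑ k, leviCivita i j k * metric x a k := by
  simp only [areaForm_eq]
  refine (partialDeriv_sum _ a (fun k _ => (smooth_coord k).const_mul _) x).trans ?_
  simp only [partialDeriv_const_mul a _ (smooth_coord _), partialDeriv_coord]

lemma leviCivita_eq (i j k : Fin 3) : leviCivita i j k
    = (x : E3) i * areaForm x j k + (x : E3) j * areaForm x k i + (x : E3) k * areaForm x i j := by
  have h := sum_coord_sq x
  simp only [areaForm_eq, leviCivita, Fin.sum_univ_three] at h ⊢
  fin_cases i <;> fin_cases j <;> fin_cases k <;> simp <;> linarith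

lemma sum_coord_mul_areaForm (j : Fin 3) : ∑ i, (x : E3) i * areaForm x i j = 0 := by
  simp only [areaForm_eq, leviCivita, Fin.sum_univ_three]
  fin_cases j <;> simp <;> ring

lemma sum_coord_mul_areaForm_right (i : Fin 3) : ∑ j, (x : E3) j * areaForm x i j = 0 := by
  simp_rw [areaForm_antisymm x i, mul_neg, Finset.sum_neg_distrib, sum_coord_mul_areaForm,
    neg_zero]

lemma sum_areaForm_mul_metric (i j : Fin 3) :
    ∑ d, areaForm x i d * metric x d j = areaForm x i j := by
  simp_rw [mul_comm (areaForm x i _), metric_symm x _ j]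
  exact sum_metric_mul_of_tangent x (sum_coord_mul_areaForm_right x i) j

lemma sum_areaForm_mul_areaForm (i j : Fin 3) :
    ∑ d, areaForm x i d * areaForm x d j = - metric x i j := by
  have h := sum_coord_sq x
  simp only [areaForm_eq, leviCivita, metric, Fin.sum_univ_three] at h ⊢
  fin_cases i <;> fin_cases j <;> simp <;> linarith

/-- The rotation `v_A ↦ ε_A^B v_B` by a right angle in the tangent plane at `x`; `eps2` applies it
to the first index of a tensor. -/
def rotate (x : S2) (v : Fin 3 → ℝ) (i : Fin 3) : ℝ := ∑ d, areaForm x i d * v d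

lemma sum_coord_mul_rotate (v : Fin 3 → ℝ) : ∑ i, (x : E3) i * rotate x v i = 0 := by
  simp_rw [rotate, Finset.mul_sum, ← mul_assoc]
  rw [Finset.sum_comm]
  simp [← Finset.sum_mul, sum_coord_mul_areaForm]

lemma rotate_rotate {v : Fin 3 → ℝ} (hv : ∑ i, (x : E3) i * v i = 0) (i : Fin 3) :
    rotate x (rotate x v) i = - v i := by
  rw [← sum_metric_mul_of_tangent x hv i, ← Finset.sum_neg_distrib]
  simp_rw [← neg_mul, ← sum_areaForm_mul_areaForm, rotate, Finset.mul_sum, Finset.sum_mul]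
  rw [Finset.sum_comm]
  simp only [mul_assoc]

lemma sum_rotate_mul (v w : Fin 3 → ℝ) :
    ∑ i, rotate x v i * w i = - ∑ i, v i * rotate x w i := by
  simp_rw [rotate, Finset.mul_sum, Finset.sum_mul, ← Finset.sum_neg_distrib]
  rw [Finset.sum_comm]
  refine Finset.sum_congr rfl fun i _ => Finset.sum_congr rfl fun d _ => ?_
  rw [areaForm_antisymm x d i]
  ring

lemma sum_rotate_mul_rotate (v : Fin 3 → ℝ) {w : Fin 3 → ℝ}
    (hw : ∑ i, (x : E3) i * w i = 0) : ∑ i, rotate x v i * rotate x w i = ∑ i, v i * w i := by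
  simp [sum_rotate_mul, rotate_rotate x hw]

lemma smooth_rotate {w : S2 → Fin 3 → ℝ} (hw : Smooth w) : Smooth (fun x => rotate x (w x)) :=
  smooth_pi.mpr fun i => .sum fun d _ => (smooth_areaForm i d).mul (smooth_pi.mp hw d)

/-- The left-hand side is antisymmetric and tangential, hence a multiple of the area form. -/
lemma rotate_sub_rotate {t : Fin 3 → Fin 3 → ℝ} (ht : ∀ j, ∑ i, (x : E3) i * t i j = 0)
    (hs : ∀ i j, t i j = t j i) (i j : Fin 3) :
    rotate x (fun d => t d j) i - rotate x (fun d => t d i) j = areaForm x i j * ∑ d, t d d := by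
  have h0 := ht 0
  have h1 := ht 1
  have h2 := ht 2
  simp only [rotate, areaForm_eq, leviCivita, Fin.sum_univ_three] at h0 h1 h2 ⊢
  fin_cases i <;> fin_cases j <;> simp [hs 1 0, hs 2 0, hs 2 1] at h0 h1 h2 ⊢
  · linear_combination -h2
  · linear_combination h1
  · linear_combination h2
  · linear_combination -h0
  · linear_combination -h1
  · linear_combination h0

end AreaForm

section Duality
variable {S T : S2 → Fin 3 → Fin 3 → ℝ}

lemma IsSymTraceless.tangent (h : IsSymTraceless T) (j : Fin 3) :
    IsOneForm (fun x i => T x i j) := fun x => (h x).1 j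

lemma IsSymTraceless.symm (h : IsSymTraceless T) (x : S2) (i j : Fin 3) : T x i j = T x j i :=
  (h x).2.1 i j

lemma IsSymTraceless.trace (h : IsSymTraceless T) (x : S2) : ∑ i, T x i i = 0 := (h x).2.2

lemma IsSymTraceless.tangent_right (h : IsSymTraceless T) (i : Fin 3) :
    IsOneForm (fun x => T x i) := fun x => by
  simpa only [h.symm x i] using h.tangent i x

lemma IsSymTraceless.div2_eq_div1 (h : IsSymTraceless T) (hT : Smooth T) (x : S2) (j : Fin 3) :
    div2 T x j = div1 (fun y i => T y i j) x :=
  NullInfinity.div2_eq_div1 hT h.tangent_right (h.trace x) j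

lemma IsSymTraceless.sum_covD2_eq_div2 (h : IsSymTraceless T) (x : S2) (d : Fin 3) :
    ∑ b, covD2 T x b d b = div2 T x d := by
  refine Finset.sum_congr rfl fun b _ => Finset.sum_congr rfl fun a _ => ?_
  rw [Finset.sum_comm]
  refine Finset.sum_congr rfl fun c _ => Finset.sum_congr rfl fun e _ => ?_
  simp_rw [h.symm _ e c]
  ring

lemma smoothOn_eps2 {u₁ u₂ : ℝ} {T : ℝ → S2 → Fin 3 → Fin 3 → ℝ} (hT : SmoothOn u₁ u₂ T) :
    SmoothOn u₁ u₂ (fun u => eps2 (T u)) :=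
  smoothOn_pi₂.mpr fun i j => .sum fun d _ =>
    ((smooth_areaForm i d).smoothOn u₁ u₂).mul (smoothOn_pi₂.mp hT d j)

lemma smooth_eps2 (hT : Smooth T) : Smooth (eps2 T) :=
  .of_smoothOn (smoothOn_eps2 (hT.smoothOn 0 1))

lemma IsSymTraceless.eps2_symm (h : IsSymTraceless T) (x : S2) (i j : Fin 3) :
    eps2 T x i j = eps2 T x j i := by
  have := rotate_sub_rotate x (h x).1 (h.symm x) i j
  rw [h.trace, mul_zero] at this
  exact sub_eq_zero.mp this

lemma IsSymTraceless.eps2 (h : IsSymTraceless T) : IsSymTraceless (eps2 T) := fun x =>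
  ⟨fun _ => sum_coord_mul_rotate x _, h.eps2_symm x, by
    simp_rw [NullInfinity.eps2, h.symm x _ _]
    exact sum_sum_mul_eq_zero_of_antisymm_of_symm (areaForm_antisymm x) (h.symm x)⟩

lemma eps2_eps2 (hT : ∀ j, IsOneForm (fun x i => T x i j)) (x : S2) (i j : Fin 3) :
    eps2 (eps2 T) x i j = - T x i j :=
  rotate_rotate x (hT j x) i

lemma inner2_eps2 (S : S2 → Fin 3 → Fin 3 → ℝ) (hT : ∀ j, IsOneForm (fun x i => T x i j)) :
    inner2 (eps2 S) (eps2 T) = inner2 S T := by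
  funext x
  simp only [inner2]
  rw [Finset.sum_comm, Finset.sum_comm (f := fun i j => S x i j * T x i j)]
  exact Finset.sum_congr rfl fun j _ => sum_rotate_mul_rotate x _ (hT j x)

lemma IsSymTraceless.sum_eps2_mul_rotate (hS : IsSymTraceless S) (x : S2) {v : Fin 3 → ℝ}
    (hv : ∑ i, (x : E3) i * v i = 0) (i : Fin 3) :
    ∑ b, NullInfinity.eps2 S x i b * rotate x v b = ∑ b, S x i b * v b := by
  simp_rw [hS.eps2_symm x i, hS.symm x i]
  exact sum_rotate_mul_rotate x _ hv

lemma IsSymTraceless.div2_eps2 (h : IsSymTraceless T) (hT : Smooth T) (x : S2) (j : Fin 3) :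
    div2 (NullInfinity.eps2 T) x j = rotate x (div2 T x) j := by
  have hT' := smooth_pi₂.mp hT
  have contraction : ∑ d, ∑ k, leviCivita j d k * T x d k = 0 :=
    sum_sum_mul_eq_zero_of_antisymm_of_symm (leviCivita_swap_right j) (h.symm x)
  have leibniz (b : Fin 3) : partialDeriv b (fun y => NullInfinity.eps2 T y b j) x
      = ∑ d, ((∑ k, leviCivita j d k * metric x b k) * T x b d
        + areaForm x j d * partialDeriv b (fun y => T y b d) x) := by
    simp_rw [h.eps2_symm _ b j, NullInfinity.eps2, h.symm _ _ b]
    rw [partialDeriv_sum _ b fun d _ => (smooth_areaForm j d).mul (hT' b d)]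
    simp only [partialDeriv_mul b (smooth_areaForm j _) (hT' b _), partialDeriv_areaForm]
  have project (d k : Fin 3) : ∑ b, metric x b k * T x b d = T x d k := by
    simp_rw [metric_symm x _ k, h.symm x d k]
    exact sum_metric_mul_of_tangent x (h.tangent d x) k
  calc div2 (NullInfinity.eps2 T) x j
      = ∑ b, partialDeriv b (fun y => NullInfinity.eps2 T y b j) x := by
        rw [h.eps2.div2_eq_div1 (smooth_eps2 hT), div1_eq (smooth_pi.mpr fun i =>
          smooth_pi₂.mp (smooth_eps2 hT) i j)]
    _ = ∑ d, ∑ k, leviCivita j d k * ∑ b, metric x b k * T x b d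
        + ∑ d, areaForm x j d * ∑ b, partialDeriv b (fun y => T y b d) x := by
        simp only [leibniz, Fin.sum_univ_three]; ring
    _ = rotate x (div2 T x) j := by
        simp only [project, contraction, zero_add, rotate, h.div2_eq_div1 hT,
          div1_eq (smooth_pi.mpr fun i => hT' i _)]

lemma sum_eps2_mul_div2_eps2 (hS : IsSymTraceless S) (hT : IsSymTraceless T)
    (hs : Smooth T) (x : S2) (i : Fin 3) :
    ∑ b, eps2 S x i b * div2 (eps2 T) x b = ∑ b, S x i b * div2 T x b := by
  simp_rw [hT.div2_eps2 hs]
  exact hS.sum_eps2_mul_rotate x (isOneForm_div2 T x) i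

/-- The quadratic terms of the evolution equation of the angular momentum aspect. -/
def angMomQuadratic (C N : S2 → Fin 3 → Fin 3 → ℝ) (x : S2) (i : Fin 3) : ℝ :=
  1 / 4 * grad (inner2 C N) x i - 1 / 4 * div2 (fun y b a => ∑ d, C y b d * N y d a) x i
    + 1 / 2 * ∑ b, C x i b * div2 N x b

lemma angMomRHS_eq (m : S2 → ℝ) (C N : S2 → Fin 3 → Fin 3 → ℝ) (x : S2) (i : Fin 3) :
    angMomRHS m C N x i
      = grad m x i - 1 / 4 * div2 (curl (div2 C)) x i + angMomQuadratic C N x i := by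
  change grad m x i - 1 / 4 * div2 (curl (div2 C)) x i + _ - _ + _ = _
  rw [angMomQuadratic]
  ring

lemma angMomQuadratic_eps2 (hS : IsSymTraceless S) (hT : IsSymTraceless T) (hs : Smooth T) :
    angMomQuadratic (eps2 S) (eps2 T) = angMomQuadratic S T := by
  have product (y : S2) (b a : Fin 3) :
      ∑ d, eps2 S y b d * eps2 T y d a = ∑ d, S y b d * T y d a :=
    hS.sum_eps2_mul_rotate y ((hT y).1 a) b
  funext x i
  simp only [angMomQuadratic, product, inner2_eps2 S hT.tangent, sum_eps2_mul_div2_eps2 hS hT hs]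

/-- The shear term `¼ C_A^D ∇^B C_DB` subtracted from `N_A` in the charge integrands. -/
def shearAspect (C : S2 → Fin 3 → Fin 3 → ℝ) (x : S2) (i : Fin 3) : ℝ :=
  1 / 4 * ∑ d, C x i d * ∑ b, covD2 C x b d b

lemma shearAspect_eps2 (hT : IsSymTraceless T) (hs : Smooth T) :
    shearAspect (eps2 T) = shearAspect T := by
  funext x i
  simp only [shearAspect, hT.sum_covD2_eq_div2, hT.eps2.sum_covD2_eq_div2,
    sum_eps2_mul_div2_eps2 hT hT hs]

end Duality

/-! ### Integration by parts on the sphere -/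

section IntegrationByParts
variable {f : S2 → ℝ} {v w w' : S2 → Fin 3 → ℝ} {T : S2 → Fin 3 → Fin 3 → ℝ}

lemma sphereIntegral_div1 (hw : Smooth w) (ht : IsOneForm w) : sphereIntegral (div1 w) = 0 := by
  have hw' := smooth_pi.mp hw
  calc sphereIntegral (div1 w)
      = ∑ a, sphereIntegral (partialDeriv a fun x => w x a) := by
        rw [funext (div1_eq hw), sphereIntegral_sum fun a _ => smooth_partialDeriv a (hw' a)]
    _ = 2 * sphereIntegral (fun x => ∑ a, coord a x * w x a) := by
        rw [sphereIntegral_sum fun a _ => (smooth_coord a).mul (hw' a), Finset.mul_sum]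
        simp only [sphereIntegral_partialDeriv (hw' _)]
    _ = 0 := by simp [coord, ht _, sphereIntegral]

/-- The `L²` inner product `∫ v^A w_A` of one-forms. -/
def pairing (v w : S2 → Fin 3 → ℝ) : ℝ := sphereIntegral fun x => ∑ i, v x i * w x i

lemma smooth_sum_mul (hv : Smooth v) (hw : Smooth w) : Smooth (fun x => ∑ i, v x i * w x i) :=
  .sum fun i _ => (smooth_pi.mp hv i).mul (smooth_pi.mp hw i)

lemma pairing_comm (v w : S2 → Fin 3 → ℝ) : pairing v w = pairing w v := by
  simp only [pairing, mul_comm]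

lemma pairing_add_right (hv : Smooth v) (hw : Smooth w) (hw' : Smooth w') :
    pairing v (fun x i => w x i + w' x i) = pairing v w + pairing v w' := by
  simp only [pairing, mul_add, Finset.sum_add_distrib]
  exact sphereIntegral_add (smooth_sum_mul hv hw) (smooth_sum_mul hv hw')

lemma pairing_sub_right (hv : Smooth v) (hw : Smooth w) (hw' : Smooth w') :
    pairing v (fun x i => w x i - w' x i) = pairing v w - pairing v w' := by
  simp only [pairing, mul_sub, Finset.sum_sub_distrib]
  exact sphereIntegral_sub (smooth_sum_mul hv hw) (smooth_sum_mul hv hw')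

lemma pairing_const_mul_right (c : ℝ) (v w : S2 → Fin 3 → ℝ) :
    pairing v (fun x i => c * w x i) = c * pairing v w := by
  simp only [pairing, mul_left_comm _ c, ← Finset.mul_sum]
  exact sphereIntegral_const_mul c _

lemma pairing_grad_left (hf : Smooth f) (hw : Smooth w) (ht : IsOneForm w) :
    pairing (grad f) w = - sphereIntegral (fun x => f x * div1 w x) := by
  have total := sphereIntegral_div1 (w := fun x i => f x * w x i)
    (smooth_pi.mpr fun i => hf.mul (smooth_pi.mp hw i)) (ht.mul_left f)
  rw [funext (div1_mul hf hw), sphereIntegral_add (smooth_sum_mul (smooth_grad hf) hw)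
    (hf.mul (smooth_div1 hw))] at total
  exact eq_neg_of_add_eq_zero_left total

lemma pairing_grad_right (hf : Smooth f) (hv : Smooth v) (ht : IsOneForm v) :
    pairing v (grad f) = - sphereIntegral (fun x => f x * div1 v x) := by
  rw [pairing_comm, pairing_grad_left hf hv ht]

lemma pairing_div2 (hv : Smooth v) (htv : IsOneForm v) (hT : Smooth T)
    (left : ∀ j, IsOneForm (fun x i => T x i j)) (right : ∀ i, IsOneForm (fun x => T x i)) :
    pairing v (div2 T) = - sphereIntegral (inner2 (covD1 v) T) := by
  have hv' := smooth_pi.mp hv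
  have column (j : Fin 3) : Smooth (fun x i => T x i j) :=
    smooth_pi.mpr fun i => smooth_pi₂.mp hT i j
  have project (x : S2) :
      ∑ j, v x j * div2 T x j = ∑ j, v x j * div1 (fun y i => T y i j) x := by
    simp_rw [div2_eq_sum_metric_mul_div1]
    exact sum_mul_sum_metric_mul_of_tangent x (htv x) _
  have covariant (x : S2) :
      inner2 (covD1 v) T x = ∑ j, ∑ i, grad (fun y => v y j) x i * T x i j := by
    rw [inner2, Finset.sum_comm (f := fun j i => grad (fun y => v y j) x i * T x i j)]
    simp_rw [covD1_eq_sum_metric_mul hv, grad_eq (hv' _), mul_comm _ (T x _ _)]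
    exact Finset.sum_congr rfl fun i _ => sum_mul_sum_metric_mul_of_tangent x (right i x) _
  calc pairing v (div2 T)
      = ∑ j, sphereIntegral (fun x => v x j * div1 (fun y i => T y i j) x) := by
        rw [pairing, funext project,
          sphereIntegral_sum fun j _ => (hv' j).mul (smooth_div1 (column j))]
    _ = - ∑ j, pairing (grad fun y => v y j) (fun x i => T x i j) := by
        simp only [pairing_grad_left (hv' _) (column _) (left _), Finset.sum_neg_distrib, neg_neg]
    _ = - sphereIntegral (inner2 (covD1 v) T) := by
        rw [funext covariant, sphereIntegral_sum fun j _ =>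
          smooth_sum_mul (smooth_grad (hv' j)) (column j)]
        rfl

end IntegrationByParts

/-! ### Conformal and Killing fields -/

section ConformalFields

/-- The rotation field `ε_A^B ∇_B X^k`, a Killing field. -/
def rotationField (k : Fin 3) (x : S2) : Fin 3 → ℝ := rotate x (grad (coord k) x)

lemma rotationField_eq (k : Fin 3) (x : S2) (i : Fin 3) :
    rotationField k x i = areaForm x i k := by
  simp only [rotationField, rotate, grad_coord, sum_areaForm_mul_metric]

lemma smooth_rotationField (k : Fin 3) : Smooth (rotationField k) := by
  simp only [smooth_pi, rotationField_eq]
  exact fun i => smooth_areaForm i k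

lemma isOneForm_rotationField (k : Fin 3) : IsOneForm (rotationField k) := fun x =>
  sum_coord_mul_rotate x _

lemma hess_coord (k : Fin 3) (x : S2) (i j : Fin 3) :
    hess (coord k) x i j = - coord k x * metric x i j := by
  rw [hess, (isOneForm_grad _).covD1_eq (smooth_grad (smooth_coord k))]
  have leibniz : partialDeriv i (fun y => metric y j k) x
      = - (metric x i j * coord k x + coord j x * metric x i k) := by
    simp only [metric]
    refine (partialDeriv_sub i (smooth_const _)
      ((smooth_coord j).mul (smooth_coord k)) x).trans ?_
    rw [partialDeriv_const, partialDeriv_mul i (smooth_coord j) (smooth_coord k),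
      partialDeriv_coord, partialDeriv_coord, metric, metric]
    ring
  simp_rw [grad_coord, leibniz, coord]
  ring

lemma covD1_rotationField (k : Fin 3) (x : S2) (i j : Fin 3) :
    covD1 (rotationField k) x i j = coord k x * areaForm x i j := by
  rw [(isOneForm_rotationField k).covD1_eq (smooth_rotationField k)]
  simp_rw [rotationField_eq, partialDeriv_areaForm, mul_comm (leviCivita j k _), sum_metric_mul,
    mul_comm _ (leviCivita j k _), ← areaForm_eq]
  rw [leviCivita_eq x, areaForm_antisymm x k i, coord]
  ring

lemma lap_coord (k : Fin 3) (x : S2) : lap (coord k) x = -2 * coord k x := by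
  have trace_metric : ∑ i, metric x i i = 2 := by
    simp only [metric, if_true, Finset.sum_sub_distrib, sum_coord_sq]
    norm_num
  simp_rw [lap, hess_coord, ← Finset.mul_sum, trace_metric]
  ring

lemma div1_rotationField (k : Fin 3) (x : S2) : div1 (rotationField k) x = 0 := by
  simp_rw [div1, covD1_rotationField, ← Finset.mul_sum]
  simp [areaForm_eq, leviCivita]

variable {f : S2 → ℝ} {w : S2 → Fin 3 → ℝ} {T : S2 → Fin 3 → Fin 3 → ℝ}

lemma pairing_grad_coord_grad (k : Fin 3) (hf : Smooth f) :
    pairing (grad (coord k)) (grad f) = 2 * sphereIntegral (fun x => f x * coord k x) := by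
  rw [pairing_grad_right hf (smooth_grad (smooth_coord k)) (isOneForm_grad _)]
  change - sphereIntegral (fun x => f x * lap (coord k) x) = _
  simp_rw [lap_coord, mul_left_comm _ (-2 : ℝ), sphereIntegral_const_mul]
  ring

lemma pairing_rotationField_grad (k : Fin 3) (hf : Smooth f) :
    pairing (rotationField k) (grad f) = 0 := by
  rw [pairing_grad_right hf (smooth_rotationField k) (isOneForm_rotationField k)]
  simp [div1_rotationField, sphereIntegral]

lemma pairing_grad_coord_div2 (k : Fin 3) (hT : Smooth T)
    (left : ∀ j, IsOneForm (fun x i => T x i j)) (right : ∀ i, IsOneForm (fun x => T x i))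
    (trace : ∀ x, ∑ i, T x i i = 0) : pairing (grad (coord k)) (div2 T) = 0 := by
  have traceless (x : S2) : inner2 (hess (coord k)) T x = 0 := by
    simp_rw [inner2, hess_coord, mul_assoc, ← Finset.mul_sum,
      sum_metric_mul_of_tangent x (right _ x), trace, mul_zero]
  rw [pairing_div2 (smooth_grad (smooth_coord k)) (isOneForm_grad _) hT left right]
  change - sphereIntegral (inner2 (hess (coord k)) T) = 0
  rw [funext traceless]
  simp [sphereIntegral]

lemma pairing_rotationField_div2 (k : Fin 3) (hT : Smooth T)
    (left : ∀ j, IsOneForm (fun x i => T x i j)) (right : ∀ i, IsOneForm (fun x => T x i)) :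
    pairing (rotationField k) (div2 T)
      = - sphereIntegral (fun x => coord k x * ∑ i, ∑ j, areaForm x i j * T x i j) := by
  rw [pairing_div2 (smooth_rotationField k) (isOneForm_rotationField k) hT left right]
  congr 2
  funext x
  simp only [inner2, covD1_rotationField, mul_assoc, Finset.mul_sum]

lemma pairing_rotationField_div2_of_symm (k : Fin 3) (hT : Smooth T)
    (left : ∀ j, IsOneForm (fun x i => T x i j)) (symm : ∀ x i j, T x i j = T x j i) :
    pairing (rotationField k) (div2 T) = 0 := by
  have right (i : Fin 3) : IsOneForm (fun x => T x i) := fun x => by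
    simpa only [symm x i] using left i x
  rw [pairing_rotationField_div2 k hT left right]
  simp [sum_sum_mul_eq_zero_of_antisymm_of_symm (areaForm_antisymm _) (symm _), sphereIntegral]

lemma sum_areaForm_mul_covD1 (hw : Smooth w) (x : S2) :
    ∑ i, ∑ j, areaForm x i j * covD1 w x i j = div1 (fun y => rotate y (w y)) x := by
  have hw' := smooth_pi.mp hw
  have divergence_free (d : Fin 3) : ∑ i, partialDeriv i (fun y => areaForm y i d) x = 0 := by
    simpa only [div1_eq (smooth_rotationField d), rotationField_eq] using div1_rotationField d x
  calc ∑ i, ∑ j, areaForm x i j * covD1 w x i j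
      = ∑ i, ∑ j, areaForm x i j * partialDeriv i (fun y => w y j) x := by
        simp_rw [covD1_eq_sum_metric_mul hw,
          sum_mul_sum_metric_mul_of_tangent x (sum_coord_mul_areaForm_right x _)]
    _ = ∑ d, (∑ i, partialDeriv i (fun y => areaForm y i d) x) * w x d
        + ∑ i, ∑ d, areaForm x i d * partialDeriv i (fun y => w y d) x := by
        simp only [divergence_free, zero_mul, Finset.sum_const_zero, zero_add]
    _ = div1 (fun y => rotate y (w y)) x := by
        simp_rw [div1_eq (smooth_rotate hw), rotate,
          partialDeriv_sum _ _ fun d _ => (smooth_areaForm _ d).mul (hw' d),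
          partialDeriv_mul _ (smooth_areaForm _ _) (hw' _), Finset.sum_add_distrib, Finset.sum_mul]
        rw [Finset.sum_comm]

lemma sum_areaForm_mul_curl (hw : Smooth w) (x : S2) :
    ∑ i, ∑ j, areaForm x i j * curl w x i j = 2 * div1 (fun y => rotate y (w y)) x := by
  have swap : ∑ i, ∑ j, areaForm x i j * covD1 w x j i
      = - ∑ i, ∑ j, areaForm x i j * covD1 w x i j := by
    rw [Finset.sum_comm]
    simp_rw [← Finset.sum_neg_distrib]
    refine Finset.sum_congr rfl fun i _ => Finset.sum_congr rfl fun j _ => ?_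
    rw [areaForm_antisymm x j i, neg_mul]
  simp_rw [curl, mul_sub, Finset.sum_sub_distrib]
  rw [swap, sum_areaForm_mul_covD1 hw]
  ring

/-- Commuting the derivatives in `div2 (curl w)` produces the Gauss curvature, whence the
right-hand side. -/
lemma pairing_rotationField_div2_curl (k : Fin 3) (hw : Smooth w) :
    pairing (rotationField k) (div2 (curl w)) = -2 * pairing (rotationField k) w := by
  have adjoint : pairing (grad (coord k)) (fun x => rotate x (w x))
      = - pairing (rotationField k) w := by
    simp only [pairing, rotationField, sum_rotate_mul, sphereIntegral, integral_neg, neg_neg]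
  rw [pairing_rotationField_div2 k (smooth_curl hw) (isOneForm_curl_left w)
    (isOneForm_curl_right w)]
  simp_rw [sum_areaForm_mul_curl hw, mul_left_comm _ (2 : ℝ), sphereIntegral_const_mul]
  linarith [pairing_grad_left (smooth_coord k) (smooth_rotate hw)
    fun x => sum_coord_mul_rotate x (w x)]

end ConformalFields

/-! ### The evolution equations -/

section RightHandSides
variable {u₁ u₂ : ℝ} (h12 : u₁ < u₂) {m : ℝ → S2 → ℝ} {C N : ℝ → S2 → Fin 3 → Fin 3 → ℝ}
include h12

lemma smoothOn_massRHS (hN : SmoothOn u₁ u₂ N) : SmoothOn u₁ u₂ (fun u => massRHS (N u)) :=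
  ((smoothOn_div1 h12 (smoothOn_div2 h12 hN)).const_mul _).sub ((hN.inner2 hN).const_mul _)

lemma smoothOn_angMomQuadratic (hC : SmoothOn u₁ u₂ C) (hN : SmoothOn u₁ u₂ N) :
    SmoothOn u₁ u₂ (fun u => angMomQuadratic (C u) (N u)) := by
  have product : SmoothOn u₁ u₂ (fun u x b a => ∑ d, C u x b d * N u x d a) :=
    smoothOn_pi₂.mpr fun b a => .sum fun d _ =>
      (smoothOn_pi₂.mp hC b d).mul (smoothOn_pi₂.mp hN d a)
  exact smoothOn_pi.mpr fun i =>
    (((smoothOn_pi.mp (smoothOn_grad h12 (hC.inner2 hN)) i).const_mul _).sub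
      ((smoothOn_pi.mp (smoothOn_div2 h12 product) i).const_mul _)).add
    (.const_mul _ (.sum fun b _ =>
      (smoothOn_pi₂.mp hC i b).mul (smoothOn_pi.mp (smoothOn_div2 h12 hN) b)))

lemma smoothOn_angMomRHS (hm : SmoothOn u₁ u₂ m) (hC : SmoothOn u₁ u₂ C)
    (hN : SmoothOn u₁ u₂ N) : SmoothOn u₁ u₂ (fun u => angMomRHS (m u) (C u) (N u)) := by
  simp only [smoothOn_pi, angMomRHS_eq]
  exact fun i => ((smoothOn_pi.mp (smoothOn_grad h12 hm) i).sub
    ((smoothOn_pi.mp (smoothOn_div2 h12 (smoothOn_curl h12 (smoothOn_div2 h12 hC))) i).const_mul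
      _)).add (smoothOn_pi.mp (smoothOn_angMomQuadratic h12 hC hN) i)

end RightHandSides

lemma smooth_angMomQuadratic {C N : S2 → Fin 3 → Fin 3 → ℝ} (hC : Smooth C) (hN : Smooth N) :
    Smooth (angMomQuadratic C N) :=
  .of_smoothOn (smoothOn_angMomQuadratic one_pos (hC.smoothOn 0 1) (hN.smoothOn 0 1))

section Fluxes
variable {f m : S2 → ℝ} {v : S2 → Fin 3 → ℝ} {C N : S2 → Fin 3 → Fin 3 → ℝ}

lemma isOneForm_angMomRHS (m : S2 → ℝ) (hC : IsSymTraceless C) (N : S2 → Fin 3 → Fin 3 → ℝ) :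
    IsOneForm (angMomRHS m C N) := by
  have shear : IsOneForm (fun x i => ∑ b, C x i b * div2 N x b) := fun x => by
    simp_rw [Finset.mul_sum, ← mul_assoc]
    rw [Finset.sum_comm]
    simp_rw [← Finset.sum_mul, hC.tangent _ x, zero_mul, Finset.sum_const_zero]
  exact ((((isOneForm_grad m).sub ((isOneForm_div2 _).const_mul _)).add
    ((isOneForm_grad _).const_mul _)).sub ((isOneForm_div2 _).const_mul _)).add
    (shear.const_mul _)

lemma sphereIntegral_mul_massRHS (hf : Smooth f) (hN : Smooth N) :
    sphereIntegral (fun x => f x * massRHS N x)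
      = - 1 / 4 * pairing (grad f) (div2 N)
        - 1 / 8 * sphereIntegral (fun x => f x * inner2 N N x) := by
  have hdiv := smooth_div2 hN
  simp_rw [massRHS, mul_sub, mul_left_comm (f _)]
  rw [sphereIntegral_sub ((hf.mul (smooth_div1 hdiv)).const_mul _)
    ((hf.mul (smooth_inner2 hN hN)).const_mul _), sphereIntegral_const_mul,
    sphereIntegral_const_mul, pairing_grad_left hf hdiv (isOneForm_div2 N)]
  ring

lemma pairing_angMomRHS (hv : Smooth v) (hm : Smooth m) (hC : Smooth C) (hN : Smooth N) :
    pairing v (angMomRHS m C N) = pairing v (grad m)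
      - 1 / 4 * pairing v (div2 (curl (div2 C))) + pairing v (angMomQuadratic C N) := by
  have linear := smooth_grad hm
  have curvature : Smooth (fun x i => 1 / 4 * div2 (curl (div2 C)) x i) := smooth_pi.mpr fun i =>
    (smooth_pi.mp (smooth_div2 (smooth_curl (smooth_div2 hC))) i).const_mul _
  have linear' := smooth_pi.mpr fun i => (smooth_pi.mp linear i).sub (smooth_pi.mp curvature i)
  have quadratic := smooth_angMomQuadratic hC hN
  rw [funext₂ (angMomRHS_eq m C N), pairing_add_right hv linear' quadratic,
    pairing_sub_right hv linear curvature, pairing_const_mul_right]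

end Fluxes

/-! ### Existence and uniqueness of the dual data -/

section Duals
variable {u₁ u₂ : ℝ} {D D' : Fields} {C N : ℝ → S2 → Fin 3 → Fin 3 → ℝ}

/-- The solution of the evolution equations with shear `C`, news `N`, and mass and angular
momentum aspects `m` and `a` at time `u₁`: the news drives the mass aspect, which in turn drives
the angular momentum aspect, so that two quadratures suffice. -/
def evolve (u₁ : ℝ) (m : S2 → ℝ) (a : S2 → Fin 3 → ℝ) (C N : ℝ → S2 → Fin 3 → Fin 3 → ℝ) :
    Fields :=
  let mass u x := m x + ∫ v in u₁..u, massRHS (N v) x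
  { mass := mass
    angMom := fun u x i => a x i + ∫ v in u₁..u, angMomRHS (mass v) (C v) (N v) x i
    shear := C
    news := N }

lemma isNullInfinityData_evolve (h12 : u₁ < u₂) {m : S2 → ℝ} {a : S2 → Fin 3 → ℝ}
    (hm : Smooth m) (ha : Smooth a) (ht : IsOneForm a) (hC : SmoothOn u₁ u₂ C)
    (hN : SmoothOn u₁ u₂ N) (hC' : ∀ u ∈ Icc u₁ u₂, IsSymTraceless (C u))
    (hN' : ∀ u ∈ Icc u₁ u₂, IsSymTraceless (N u))
    (hd : ∀ u ∈ Icc u₁ u₂, ∀ x i j,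
      HasDerivWithinAt (fun v => C v x i j) (N u x i j) (Icc u₁ u₂) u) :
    IsNullInfinityData u₁ u₂ (evolve u₁ m a C N) := by
  have massRate := smoothOn_massRHS h12 hN
  have mass : SmoothOn u₁ u₂ (evolve u₁ m a C N).mass :=
    (hm.smoothOn u₁ u₂).add (massRate.timeIntegral h12)
  have angMomRate := smoothOn_angMomRHS h12 mass hC hN
  have angMomRate' := smoothOn_pi.mp angMomRate
  exact
  { smooth_mass := mass
    smooth_angMom := smoothOn_pi.mpr fun i =>
      ((smooth_pi.mp ha i).smoothOn u₁ u₂).add ((angMomRate' i).timeIntegral h12)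
    smooth_shear := hC
    smooth_news := hN
    oneForm_angMom := fun u hu => ht.add <|
      .timeIntegral angMomRate (fun v hv => isOneForm_angMomRHS _ (hC' v hv) _) hu
    symTraceless_shear := hC'
    symTraceless_news := hN'
    deriv_shear := hd
    deriv_mass := fun u hu x =>
      (hasDerivWithinAt_integral_Icc (massRate.continuousOn_slice x) hu).const_add _
    deriv_angMom := fun u hu x i =>
      (hasDerivWithinAt_integral_Icc ((angMomRate' i).continuousOn_slice x) hu).const_add _ }

lemma hasDerivWithinAt_eps2 {s : Set ℝ} {u : ℝ} {T : S2 → Fin 3 → Fin 3 → ℝ} {x : S2}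
    (h : ∀ i j, HasDerivWithinAt (fun v => C v x i j) (T x i j) s u) (i j : Fin 3) :
    HasDerivWithinAt (fun v => eps2 (C v) x i j) (eps2 T x i j) s u :=
  .fun_sum fun d _ => (h d j).const_mul (areaForm x i d)

theorem IsNullInfinityData.exists_isDualData (hD : IsNullInfinityData u₁ u₂ D) (h12 : u₁ < u₂) :
    ∃ D', IsDualData u₁ u₂ D D' := by
  have hu₁ : u₁ ∈ Icc u₁ u₂ := left_mem_Icc.mpr h12.le
  refine ⟨evolve u₁ (D.mass u₁) (D.angMom u₁) (fun u => eps2 (D.shear u))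
    (fun u => eps2 (D.news u)), ?_, fun _ _ => rfl, ?_, ?_⟩
  · exact isNullInfinityData_evolve h12 (hD.smooth_mass.smooth hu₁) (hD.smooth_angMom.smooth hu₁)
      (hD.oneForm_angMom u₁ hu₁) (smoothOn_eps2 hD.smooth_shear) (smoothOn_eps2 hD.smooth_news)
      (fun u hu => (hD.symTraceless_shear u hu).eps2)
      (fun u hu => (hD.symTraceless_news u hu).eps2)
      fun u hu x => hasDerivWithinAt_eps2 (hD.deriv_shear u hu x)
  · funext x
    simp [evolve]
  · funext x i
    simp [evolve]

lemma IsNullInfinityData.news_eq (hD : IsNullInfinityData u₁ u₂ D) (h12 : u₁ < u₂)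
    (hC : ∀ u ∈ Icc u₁ u₂, D.shear u = C u)
    (hd : ∀ u ∈ Icc u₁ u₂, ∀ x i j,
      HasDerivWithinAt (fun v => C v x i j) (N u x i j) (Icc u₁ u₂) u)
    {u : ℝ} (hu : u ∈ Icc u₁ u₂) : D.news u = N u := by
  funext x i j
  have shear : HasDerivWithinAt (fun v => D.shear v x i j) (N u x i j) (Icc u₁ u₂) u :=
    (hd u hu x i j).congr (fun v hv => by rw [hC v hv]) (by rw [hC u hu])
  exact (uniqueDiffOn_Icc h12 u hu).eq_deriv _ (hD.deriv_shear u hu x i j) shear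

theorem IsNullInfinityData.agreeOn (hD : IsNullInfinityData u₁ u₂ D)
    (hD' : IsNullInfinityData u₁ u₂ D') (h12 : u₁ < u₂)
    (shear : ∀ u ∈ Icc u₁ u₂, D'.shear u = D.shear u) (mass_init : D'.mass u₁ = D.mass u₁)
    (angMom_init : D'.angMom u₁ = D.angMom u₁) : AgreeOn u₁ u₂ D D' := by
  have news (u) (hu : u ∈ Icc u₁ u₂) : D'.news u = D.news u :=
    hD'.news_eq h12 shear hD.deriv_shear hu
  have mass (u) (hu : u ∈ Icc u₁ u₂) : D'.mass u = D.mass u := funext fun x =>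
    eqOn_Icc_of_hasDerivWithinAt (fun v hv => news v hv ▸ hD'.deriv_mass v hv x)
      (fun v hv => hD.deriv_mass v hv x) (congrFun mass_init x) hu
  have angMom (u) (hu : u ∈ Icc u₁ u₂) : D'.angMom u = D.angMom u := funext₂ fun x i =>
    eqOn_Icc_of_hasDerivWithinAt
      (fun v hv => news v hv ▸ mass v hv ▸ shear v hv ▸ hD'.deriv_angMom v hv x i)
      (fun v hv => hD.deriv_angMom v hv x i) (congrFun₂ angMom_init x i) hu
  exact fun u hu => ⟨mass u hu, angMom u hu, shear u hu, news u hu⟩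

end Duals

/-! ### Invariance of the charges -/

section Charges

lemma smooth_shearAspect {C : S2 → Fin 3 → Fin 3 → ℝ} (hC : IsSymTraceless C) (hs : Smooth C) :
    Smooth (shearAspect C) := by
  simp only [smooth_pi, shearAspect, hC.sum_covD2_eq_div2]
  exact fun i => .const_mul _ (smooth_sum_mul (smooth_pi.mp hs i) (smooth_div2 hs))

lemma grad_const (c : ℝ) (x : S2) (i : Fin 3) : grad (fun _ => c) x i = 0 := by
  rw [grad_eq (smooth_const c), partialDeriv_const]

variable {u₁ u₂ u : ℝ} {D D' : Fields}

lemma IsNullInfinityData.angularMomentum_eq_pairing (hD : IsNullInfinityData u₁ u₂ D)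
    (hu : u ∈ Icc u₁ u₂) (k : Fin 3) :
    angularMomentum D u k = pairing (rotationField k) (D.angMom u)
      - pairing (rotationField k) (shearAspect (D.shear u)) :=
  pairing_sub_right (smooth_rotationField k) (hD.smooth_angMom.smooth hu)
    (smooth_shearAspect (hD.symTraceless_shear u hu) (hD.smooth_shear.smooth hu))

lemma IsNullInfinityData.centerOfMass_eq_pairing (hD : IsNullInfinityData u₁ u₂ D)
    (hu : u ∈ Icc u₁ u₂) (k : Fin 3) :
    centerOfMass D u k = pairing (grad (coord k)) (D.angMom u)
      - pairing (grad (coord k)) (shearAspect (D.shear u))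
      - u * pairing (grad (coord k)) (grad (D.mass u))
      - 1 / 16 * pairing (grad (coord k)) (grad (inner2 (D.shear u) (D.shear u))) := by
  have smooth_dipole := smooth_grad (smooth_coord k)
  have smooth_shear := hD.smooth_shear.smooth hu
  have angMom := hD.smooth_angMom.smooth hu
  have aspect := smooth_shearAspect (hD.symTraceless_shear u hu) smooth_shear
  have mass : Smooth (fun x i => u * grad (D.mass u) x i) := smooth_pi.mpr fun i =>
    (smooth_pi.mp (smooth_grad (hD.smooth_mass.smooth hu)) i).const_mul u
  have square : Smooth (fun x i => 1 / 16 * grad (inner2 (D.shear u) (D.shear u)) x i) :=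
    smooth_pi.mpr fun i =>
      (smooth_pi.mp (smooth_grad (smooth_inner2 smooth_shear smooth_shear)) i).const_mul _
  have corrected := smooth_pi.mpr fun i => (smooth_pi.mp angMom i).sub (smooth_pi.mp aspect i)
  have drifted := smooth_pi.mpr fun i => (smooth_pi.mp corrected i).sub (smooth_pi.mp mass i)
  rw [← pairing_sub_right smooth_dipole angMom aspect, ← pairing_const_mul_right u,
    ← pairing_sub_right smooth_dipole corrected mass, ← pairing_const_mul_right (1 / 16),
    ← pairing_sub_right smooth_dipole drifted square]
  rfl

variable (hD : IsNullInfinityData u₁ u₂ D) (h12 : u₁ < u₂) (h : IsDualData u₁ u₂ D D')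
  (hu : u ∈ Icc u₁ u₂)
include hD h12 h hu

theorem IsDualData.news_eq : D'.news u = eps2 (D.news u) :=
  h.isData.news_eq h12 h.shear_eq (fun u hu x => hasDerivWithinAt_eps2 (hD.deriv_shear u hu x)) hu

lemma IsDualData.sphereIntegral_mul_mass_eq {f : S2 → ℝ} (hf : Smooth f)
    (hdiv : ∀ T, Smooth T → IsSymTraceless T → pairing (grad f) (div2 T) = 0) :
    sphereIntegral (fun x => f x * D'.mass u x) = sphereIntegral (fun x => f x * D.mass u x) := by
  have mass {E : Fields} (hE : IsNullInfinityData u₁ u₂ E) :=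
    (hf.smoothOn u₁ u₂).mul hE.smooth_mass
  have rate {E : Fields} (hE : IsNullInfinityData u₁ u₂ E) :=
    (hf.smoothOn u₁ u₂).mul (smoothOn_massRHS h12 hE.smooth_news)
  have flux {E : Fields} (hE : IsNullInfinityData u₁ u₂ E) (v : ℝ) (hv : v ∈ Icc u₁ u₂) :
      sphereIntegral (fun x => f x * massRHS (E.news v) x)
        = - 1 / 8 * sphereIntegral (fun x => f x * inner2 (E.news v) (E.news v) x) := by
    have news := hE.smooth_news.smooth hv
    rw [sphereIntegral_mul_massRHS hf news, hdiv _ news (hE.symTraceless_news v hv)]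
    ring
  refine sphereIntegral_eq_of_flux_eq (mass h.isData) (rate h.isData) (mass hD) (rate hD)
    (fun v hv x => (h.isData.deriv_mass v hv x).const_mul _)
    (fun v hv x => (hD.deriv_mass v hv x).const_mul _) (by rw [h.mass_init]) (fun v hv => ?_) hu
  rw [flux h.isData v hv, flux hD v hv, h.news_eq hD h12 hv,
    inner2_eps2 _ (hD.symTraceless_news v hv).tangent]

theorem IsDualData.energy_eq : energy D' u = energy D u := by
  refine h.sphereIntegral_mul_mass_eq hD h12 hu (smooth_const 2) fun T _ _ => ?_
  simp [pairing, grad_const, sphereIntegral]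

lemma IsDualData.sphereIntegral_coord_mul_mass_eq (k : Fin 3) :
    sphereIntegral (fun x => coord k x * D'.mass u x)
      = sphereIntegral (fun x => coord k x * D.mass u x) :=
  h.sphereIntegral_mul_mass_eq hD h12 hu (smooth_coord k) fun _ hT ht =>
    pairing_grad_coord_div2 k hT ht.tangent ht.tangent_right ht.trace

theorem IsDualData.linearMomentum_eq (k : Fin 3) :
    linearMomentum D' u k = linearMomentum D u k := by
  simp only [linearMomentum, mul_comm _ (coord k _), mul_left_comm _ (2 : ℝ),
    sphereIntegral_const_mul, h.sphereIntegral_coord_mul_mass_eq hD h12 hu k]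

lemma IsDualData.pairing_angMom_eq {v : S2 → Fin 3 → ℝ} (hv : Smooth v)
    (hmass : ∀ t ∈ Icc u₁ u₂, pairing v (grad (D'.mass t)) = pairing v (grad (D.mass t)))
    (hcurl : ∀ T, Smooth T → IsSymTraceless T → pairing v (div2 (curl (div2 T))) = 0) :
    pairing v (D'.angMom u) = pairing v (D.angMom u) := by
  have hv' (i : Fin 3) := (smooth_pi.mp hv i).smoothOn u₁ u₂
  have angMom {E : Fields} (hE : IsNullInfinityData u₁ u₂ E) :=
    SmoothOn.sum (s := .univ) fun i _ => (hv' i).mul (smoothOn_pi.mp hE.smooth_angMom i)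
  have rate {E : Fields} (hE : IsNullInfinityData u₁ u₂ E) :=
    SmoothOn.sum (s := .univ) fun i _ => (hv' i).mul (smoothOn_pi.mp
      (smoothOn_angMomRHS h12 hE.smooth_mass hE.smooth_shear hE.smooth_news) i)
  have flux {E : Fields} (hE : IsNullInfinityData u₁ u₂ E) (t : ℝ) (ht : t ∈ Icc u₁ u₂) :
      pairing v (angMomRHS (E.mass t) (E.shear t) (E.news t))
        = pairing v (grad (E.mass t)) + pairing v (angMomQuadratic (E.shear t) (E.news t)) := by
    have shear := hE.smooth_shear.smooth ht
    rw [pairing_angMomRHS hv (hE.smooth_mass.smooth ht) shear (hE.smooth_news.smooth ht),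
      hcurl _ shear (hE.symTraceless_shear t ht), mul_zero, sub_zero]
  refine sphereIntegral_eq_of_flux_eq (angMom h.isData) (rate h.isData) (angMom hD) (rate hD)
    (fun t ht x => .fun_sum fun i _ => (h.isData.deriv_angMom t ht x i).const_mul _)
    (fun t ht x => .fun_sum fun i _ => (hD.deriv_angMom t ht x i).const_mul _)
    (by rw [h.angMom_init]) (fun t ht => ?_) hu
  refine (flux h.isData t ht).trans (.trans ?_ (flux hD t ht).symm)
  rw [hmass t ht, h.shear_eq t ht, h.news_eq hD h12 ht, angMomQuadratic_eps2
    (hD.symTraceless_shear t ht) (hD.symTraceless_news t ht) (hD.smooth_news.smooth ht)]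

omit h12 in
lemma IsDualData.shearAspect_eq : shearAspect (D'.shear u) = shearAspect (D.shear u) := by
  rw [h.shear_eq u hu, shearAspect_eps2 (hD.symTraceless_shear u hu) (hD.smooth_shear.smooth hu)]

theorem IsDualData.angularMomentum_eq (k : Fin 3) :
    angularMomentum D' u k = angularMomentum D u k := by
  have angMom := h.pairing_angMom_eq hD h12 hu (smooth_rotationField k)
    (fun t ht => by
      rw [pairing_rotationField_grad k (h.isData.smooth_mass.smooth ht),
        pairing_rotationField_grad k (hD.smooth_mass.smooth ht)])
    fun T hT ht => by
      rw [pairing_rotationField_div2_curl k (smooth_div2 hT),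
        pairing_rotationField_div2_of_symm k hT ht.tangent ht.symm, mul_zero]
  rw [h.isData.angularMomentum_eq_pairing hu, hD.angularMomentum_eq_pairing hu, angMom,
    h.shearAspect_eq hD hu]

lemma IsDualData.pairing_grad_coord_grad_mass_eq (k : Fin 3) :
    pairing (grad (coord k)) (grad (D'.mass u)) = pairing (grad (coord k)) (grad (D.mass u)) := by
  rw [pairing_grad_coord_grad k (h.isData.smooth_mass.smooth hu),
    pairing_grad_coord_grad k (hD.smooth_mass.smooth hu)]
  simp only [mul_comm _ (coord k _), h.sphereIntegral_coord_mul_mass_eq hD h12 hu k]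

theorem IsDualData.centerOfMass_eq (k : Fin 3) : centerOfMass D' u k = centerOfMass D u k := by
  have angMom := h.pairing_angMom_eq hD h12 hu (smooth_grad (smooth_coord k))
    (fun t ht => h.pairing_grad_coord_grad_mass_eq hD h12 ht k) fun T hT _ =>
      pairing_grad_coord_div2 k (smooth_curl (smooth_div2 hT)) (isOneForm_curl_left _)
        (isOneForm_curl_right _) (trace_curl _)
  rw [h.isData.centerOfMass_eq_pairing hu, hD.centerOfMass_eq_pairing hu, angMom,
    h.shearAspect_eq hD hu,
    h.pairing_grad_coord_grad_mass_eq hD h12 hu, h.shear_eq u hu,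
    inner2_eps2 _ (hD.symTraceless_shear u hu).tangent]

end Charges

/-! ### Potentials -/

section Potentials
variable {c cb f : S2 → ℝ} {T : S2 → Fin 3 → Fin 3 → ℝ}

lemma hess_symm (hf : Smooth f) (x : S2) (i j : Fin 3) : hess f x i j = hess f x j i := by
  rw [hess, (isOneForm_grad f).covD1_eq (smooth_grad hf),
    (isOneForm_grad f).covD1_eq (smooth_grad hf)]
  simp_rw [grad_eq hf]
  linarith [partialDeriv_comm i j hf x]

/-- The traceless part `∇_A ∇_B f - ½ σ_AB Δ f` of the Hessian. In terms of it, `(c, cb)` are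
potentials of `tracelessHess c + ε₂ (tracelessHess cb)`. -/
def tracelessHess (f : S2 → ℝ) (x : S2) (i j : Fin 3) : ℝ :=
  hess f x i j - 1 / 2 * metric x i j * lap f x

lemma isOneForm_tracelessHess (f : S2 → ℝ) (j : Fin 3) :
    IsOneForm (fun x i => tracelessHess f x i j) :=
  (isOneForm_covD1_left (grad f) j).sub fun x => by
    simp only [mul_right_comm _ _ (lap f x), mul_left_comm _ (1 / 2 * lap f x), ← Finset.mul_sum,
      sum_coord_mul_metric, mul_zero]

lemma hess_neg (f : S2 → ℝ) (x : S2) (i j : Fin 3) : hess (-f) x i j = - hess f x i j := by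
  have grad_neg (y : S2) (k : Fin 3) : grad (-f) y k = - grad f y k := by
    simp only [grad, partialDeriv_neg, mul_neg, Finset.sum_neg_distrib]
  have component_neg (k : Fin 3) : (fun y => grad (-f) y k) = -fun y => grad f y k :=
    funext fun y => grad_neg y k
  simp only [hess, covD1, component_neg, partialDeriv_neg, mul_neg, Finset.sum_neg_distrib]

lemma tracelessHess_neg (f : S2 → ℝ) (x : S2) (i j : Fin 3) :
    tracelessHess (-f) x i j = - tracelessHess f x i j := by
  simp only [tracelessHess, lap, hess_neg, Finset.sum_neg_distrib]
  ring

lemma eps2_tracelessHess (hf : Smooth f) (x : S2) (i j : Fin 3) :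
    eps2 (tracelessHess f) x i j = 1 / 2 * (∑ e, areaForm x i e * hess f x e j
      + ∑ e, areaForm x j e * hess f x e i) := by
  have rotated : eps2 (tracelessHess f) x i j
      = rotate x (fun d => hess f x d j) i - 1 / 2 * lap f x * areaForm x i j := by
    rw [← sum_areaForm_mul_metric x i j, rotate, Finset.mul_sum, ← Finset.sum_sub_distrib]
    refine Finset.sum_congr rfl fun d _ => ?_
    rw [tracelessHess]
    ring
  have antisymmetric_part := rotate_sub_rotate x (fun j => isOneForm_covD1_left (grad f) j x)
    (hess_symm hf x) i j
  change rotate x (fun d => hess f x d j) i - rotate x (fun d => hess f x d i) j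
    = areaForm x i j * lap f x at antisymmetric_part
  change _ = 1 / 2 * (rotate x (fun d => hess f x d j) i + rotate x (fun d => hess f x d i) j)
  linarith

lemma isPotentials_iff : IsPotentials T c cb ↔ Smooth c ∧ Smooth cb ∧
    ∀ x i j, T x i j = tracelessHess c x i j + eps2 (tracelessHess cb) x i j := by
  refine and_congr_right fun _ => and_congr_right fun hcb => ?_
  simp only [eps2_tracelessHess hcb, tracelessHess]

theorem IsPotentials.eps2 (h : IsPotentials T c cb) : IsPotentials (eps2 T) (-cb) c := by
  obtain ⟨hc, hcb, hT⟩ := isPotentials_iff.mp h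
  refine isPotentials_iff.mpr ⟨ContMDiff.neg hcb, hc, fun x i j => ?_⟩
  rw [tracelessHess_neg, ← eps2_eps2 (isOneForm_tracelessHess cb)]
  simp only [NullInfinity.eps2, hT, mul_add, Finset.sum_add_distrib]
  ring

end Potentials

end NullInfinity

end

/-- Every set of null infinity data `D` on `[u₁, u₂] × S²` has a dual set of data, unique on
`[u₁, u₂] × S²`; its news is `ε₂` of the news, potentials `(c, cb)` and `(n, nb)` are replaced by
`(-cb, c)` and `(-nb, n)`, and it has the same classical energy, linear momentum, angular momentum
and center of mass at every retarded time. -/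
theorem mainTheorem8 (u₁ u₂ : ℝ) (hu : u₁ < u₂) (D : NullInfinity.Fields)
    (hD : NullInfinity.IsNullInfinityData u₁ u₂ D) :
    ∃ D' : NullInfinity.Fields,
      NullInfinity.IsDualData u₁ u₂ D D' ∧
      (∀ D'' : NullInfinity.Fields, NullInfinity.IsDualData u₁ u₂ D D'' →
        NullInfinity.AgreeOn u₁ u₂ D' D'') ∧
      (∀ u ∈ Set.Icc u₁ u₂,
        D'.news u = NullInfinity.eps2 (D.news u) ∧
        (∀ c cb : NullInfinity.S2 → ℝ, NullInfinity.IsPotentials (D.shear u) c cb →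
          NullInfinity.IsPotentials (D'.shear u) (-cb) c) ∧
        (∀ n nb : NullInfinity.S2 → ℝ, NullInfinity.IsPotentials (D.news u) n nb →
          NullInfinity.IsPotentials (D'.news u) (-nb) n)) ∧
      (∀ u ∈ Set.Icc u₁ u₂,
        NullInfinity.energy D' u = NullInfinity.energy D u ∧
        ∀ k : Fin 3,
          NullInfinity.linearMomentum D' u k = NullInfinity.linearMomentum D u k ∧
          NullInfinity.angularMomentum D' u k = NullInfinity.angularMomentum D u k ∧
          NullInfinity.centerOfMass D' u k = NullInfinity.centerOfMass D u k) := by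
  obtain ⟨D', h⟩ := hD.exists_isDualData hu
  refine ⟨D', h, fun D'' h'' => ?_, fun u ht => ⟨h.news_eq hD hu ht, fun c cb hc => ?_,
    fun n nb hn => ?_⟩, fun u ht => ⟨h.energy_eq hD hu ht, fun k => ⟨?_, ?_, ?_⟩⟩⟩
  · exact h.isData.agreeOn h''.isData hu
      (fun u ht => (h''.shear_eq u ht).trans (h.shear_eq u ht).symm)
      (h''.mass_init.trans h.mass_init.symm) (h''.angMom_init.trans h.angMom_init.symm)
  · exact h.shear_eq u ht ▸ hc.eps2
  · exact h.news_eq hD hu ht ▸ hn.eps2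
  · exact h.linearMomentum_eq hD hu ht k
  · exact h.angularMomentum_eq hD hu ht k
  · exact h.centerOfMass_eq hD hu ht k
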